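/- **Setting.** Let $Y=[0,1)^3$, $Y'=[-\pi,\pi)^3$. Let $H^1_\#(Y;\mathbb C^3)$ be the closure of the smooth $\mathbb Z^3$-periodic functions in the norm $\|u\|_{H^1}^2=\|u\|_{L^2(Y)}^2+\|\nabla u\|_{L^2(Y)}^2$. For matrices put $B:\overline{D}=\sum_{i,j}B_{ij}\overline{D_{ij}}$ and $|B|^2=B:\overline B$; $\operatorname{sym}B=\frac12(B+B^\top)$. Let $\mathbb A=(\mathbb A^{ik}_{jl})$ be a real $\mathbb Z^3$-periodic tensor field on $\mathbb R^3$ with coefficients in $L^\infty(Y)$, acting by $(\mathbb AB)_{ij}=\sum_{k,l}\mathbb A^{ik}_{jl}B_{kl}$, with $\mathbb A^{ik}_{jl}=\mathbb A^{jk}_{il}=\mathbb A^{ki}_{lj}$ and, for some $\nu>0$, $\nu|\xi|^2\le\mathbb A(y)\xi:\xi\le\nu^{-1}|\xi|^2$ for all $y\in Y$ and all real symmetric $\xi$. For $\chi\in Y'$ write $X_\chi u=\operatorname{sym}(u\chi^\top)$. There is a constant $K>0$ such that Korn's inequality $\|u\|_{H^1}\le K\|\operatorname{sym}\nabla u\|_{L^2(Y)}$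 holds for all $u\in H^1_\#(Y;\mathbb C^3)$ with $\int_Yu=0$; let $C_{\rm Korn}$ be any such constant. Fix $\chi\in Y'\setminus\{0\}$. For each $c\in\mathbb C^3$ there is a unique $u_c\in H^1_\#$ with $\int_Y u_c=0$ and $\int_Y\mathbb A(\operatorname{sym}\nabla u_c+iX_\chi c):\overline{\operatorname{sym}\nabla v}=0$ for all $v\in H^1_\#$. Let $\mathcal A^{\rm hom}_\chi\in\mathbb C^{3\times3}$ be the matrix with $\langle\mathcal A^{\rm hom}_\chi c,d\rangle=\int_Y\mathbb A(\operatorname{sym}\nabla u_c+iX_\chi c):\overline{iX_\chi d}$ for all $c,d\in\mathbb C^3$. Fix $z\in\rho(|\chi|^{-2}\mathcal A^{\rm hom}_\chi)$, put $D^{\rm hom}_\chi(z)=\operatorname{dist}(z,\sigma(|\chi|^{-2}\mathcal A^{\rm hom}_\chi))$, and let $f\in L^2(Y;\mathbb C^3)$. **Cycle terms.** With $u_1^{(-1)}=u_2^{(-1)}=u_2^{(-2)}=0$, $f^{(0)}=f$ and $f^{(n)}=0$ for $n\ge1$, there is a unique family $u_j^{(n)}\in H^1_\#(Y;\mathbb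 C^3)$, $n\ge0$, $j\in\{0,1,2\}$, with $\int_Yu_1^{(n)}=\int_Yu_2^{(n)}=0$ such that for all $n\ge 0$, all $v\in H^1_\#(Y;\mathbb C^3)$ and all $v_0\in\mathbb C^3$ $$\int_Y\mathbb A\operatorname{sym}\nabla u_0^{(n)}:\overline{\operatorname{sym}\nabla v}=0,\qquad \int_Y\mathbb A\operatorname{sym}\nabla u_1^{(n)}:\overline{\operatorname{sym}\nabla v}=-\int_Y\mathbb A\,iX_\chi u_0^{(n)}:\overline{\operatorname{sym}\nabla v},$$ $$\begin{aligned}\int_Y\mathbb A\operatorname{sym}\nabla u_2^{(n)}:\overline{\operatorname{sym}\nabla v}={}&-\int_Y\mathbb A\,iX_\chi(u_1^{(n)}+u_2^{(n-1)}):\overline{\operatorname{sym}\nabla v}-\int_Y\mathbb A\operatorname{sym}\nabla(u_1^{(n)}+u_2^{(n-1)}):\overline{iX_\chi v}\\&-\int_Y\mathbb A\,iX_\chi(u_0^{(n)}+u_1^{(n-1)}+u_2^{(n-2)}):\overline{iX_\chi v}\\&+z|\chi|^2\int_Y(u_0^{(n)}+u_1^{(n-1)}+u_2^{(n-2)})\cdot\overline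 v+|\chi|^2\int_Yf^{(n)}\cdot\overline v,\end{aligned}$$ $$\frac1{|\chi|^2}\langle\mathcal A^{\rm hom}_\chi u_0^{(n)},v_0\rangle-z\int_Yu_0^{(n)}\cdot\overline{v_0}=-\frac1{|\chi|^2}\int_Y\mathbb A\big(\operatorname{sym}\nabla u_2^{(n-1)}+iX_\chi(u_1^{(n-1)}+u_2^{(n-2)})\big):\overline{iX_\chi v_0}+\int_Yf^{(n)}\cdot\overline{v_0}.$$ (The first equation makes $u_0^{(n)}$ constant; in the last one it is identified with its value in $\mathbb C^3$.) **Estimates.** For every $n\ge0$, $$\|u_0^{(n)}\|_{H^1}\le C^{n+1}\Big[\sum_{k=0}^{n+1}\sum_{l=0}^{n}\frac{|z|^l}{D^{\rm hom}_\chi(z)^k}\Big]|\chi|^n\|f\|_{L^2},\qquad \|u_1^{(n)}\|_{H^1}\le C^{n+1}\Big[\sum_{k=0}^{n+1}\sum_{l=0}^{n}\frac{|z|^l}{D^{\rm hom}_\chi(z)^k}\Big]|\chi|^{n+1}\|f\|_{L^2},$$ $$\|u_2^{(n)}\|_{H^1}\le C^{n+1}\Big[\sum_{k=0}^{n+1}\sum_{l=0}^{n+1}\frac{|z|^l}{D^{\rm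 hom}_\chi(z)^k}\Big]|\chi|^{n+2}\|f\|_{L^2},$$ with the constant, independent of $n$, $\chi$, $z$ and $f$, given by $C=\max\{C_0,C_1,C_2\}$, where $C_0=\max\{\frac3\nu,1\}$, $C_1=\max\{\frac{3C_{\rm Korn}}{\nu^3},\frac{C_{\rm Korn}}{\nu^2},1\}$ and $C_2=\max\{\frac{4C_{\rm Korn}^2}{\nu^2}C_1+\frac{6C_{\rm Korn}^2}{\nu}\max\{1,\frac1\nu\}C_0,\,1\}$. -/

import Mathlib

open MeasureTheory
open scoped ContDiff ComplexConjugate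

noncomputable section

namespace Fibre

/-! Points of the unit cell are written in `Fin 3 → ℝ` (only its topology, smooth structure and
Lebesgue measure are used); vectors whose Euclidean norm matters live in `EuclideanSpace`. -/

/-- The unit cell `Y = [0,1)³`. -/
def cell : Set (Fin 3 → ℝ) := Set.univ.pi fun _ => Set.Ico (0 : ℝ) 1

/-- The dual cell `Y' = [-π,π)³` of quasimomenta. -/
def dualCell : Set (EuclideanSpace ℝ (Fin 3)) :=
  {χ | ∀ i, χ i ∈ Set.Ico (-Real.pi) Real.pi}

/-- `ℂ³` with its Hermitian norm. -/
abbrev Vec : Type := EuclideanSpace ℂ (Fin 3)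

/-- `ℂ^{3×3}` with the Frobenius norm. -/
abbrev MatF : Type := EuclideanSpace ℂ (Fin 3 × Fin 3)

/-- `L²(Y; ℂ³)`. -/
abbrev L2Vec : Type := Lp Vec 2 (volume.restrict cell)

/-- `L²(Y; ℂ^{3×3})`. -/
abbrev L2Mat : Type := Lp MatF 2 (volume.restrict cell)

/-- The pairs `(φ, ∇φ)`, with `φ : ℝ³ → ℂ³` smooth and `ℤ³`-periodic and `(∇φ)_{ij} = ∂_j φ_i`,
as a subspace of `L²(Y; ℂ³) × L²(Y; ℂ^{3×3})` with the Hilbert norm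
`‖(u, g)‖² = ‖u‖²_{L²} + ‖g‖²_{L²}`. -/
def smoothPeriodic : Submodule ℂ (WithLp 2 (L2Vec × L2Mat)) where
  carrier := {p | ∃ φ : (Fin 3 → ℝ) → Vec, ContDiff ℝ ∞ φ ∧
    (∀ x j, φ (x + Pi.single j 1) = φ x) ∧
    (∀ᵐ y ∂volume.restrict cell, p.fst y = φ y) ∧
    (∀ᵐ y ∂volume.restrict cell, ∀ i j, p.snd y (i, j) = fderiv ℝ φ y (Pi.single j 1) i)}
  add_mem' := by
    rintro p q ⟨φ, hφ, hφp, h1, h2⟩ ⟨ψ, hψ, hψp, h3, h4⟩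
    refine ⟨φ + ψ, hφ.add hψ, fun x j => by simp [hφp, hψp], ?_, ?_⟩
    · filter_upwards [h1, h3, Lp.coeFn_add p.fst q.fst] with y a b c
      rw [WithLp.add_fst, c]
      simp [a, b]
    · filter_upwards [h2, h4, Lp.coeFn_add p.snd q.snd] with y a b c i j
      rw [WithLp.add_snd, c, fderiv_add (hφ.differentiable (by simp) y)
        (hψ.differentiable (by simp) y)]
      simp [a, b]
  zero_mem' := by
    refine ⟨0, contDiff_const, fun _ _ => rfl, ?_, ?_⟩
    · filter_upwards [Lp.coeFn_zero Vec 2 (volume.restrict cell)] with y a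
      rw [WithLp.zero_fst, a]
    · filter_upwards [Lp.coeFn_zero MatF 2 (volume.restrict cell)] with y a i j
      rw [WithLp.zero_snd, a]
      simp
  smul_mem' := by
    rintro c p ⟨φ, hφ, hφp, h1, h2⟩
    refine ⟨c • φ, hφ.const_smul c, fun x j => by simp [hφp], ?_, ?_⟩
    · filter_upwards [h1, Lp.coeFn_smul c p.fst] with y a b
      rw [WithLp.smul_fst, b]
      simp [a]
    · filter_upwards [h2, Lp.coeFn_smul c p.snd] with y a b i j
      rw [WithLp.smul_snd, b, fderiv_const_smul (hφ.differentiable (by simp) y)]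
      simp [a]

/-- The periodic Sobolev space `H¹_#(Y; ℂ³)`: the closure of the smooth periodic functions in the
`H¹` norm.  An element is stored together with its gradient, and the inherited norm `‖u‖` is the
`H¹(Y; ℂ³)` norm, `‖u‖² = ‖u‖²_{L²} + ‖∇u‖²_{L²}`. -/
def H1per : Submodule ℂ (WithLp 2 (L2Vec × L2Mat)) := smoothPeriodic.topologicalClosure

/-- The values of `u ∈ H¹_#`. -/
def val (u : H1per) (y : Fin 3 → ℝ) : Vec := (u : WithLp 2 (L2Vec × L2Mat)).fst y

/-- The values of `∇u`, `(∇u)_{ij} = ∂_j u_i`. -/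
def grad (u : H1per) (y : Fin 3 → ℝ) : MatF := (u : WithLp 2 (L2Vec × L2Mat)).snd y

/-- The mean `∫_Y u`. -/
def mean (u : H1per) : Vec := ∫ y in cell, val u y

/-- The symmetric gradient of `u`. -/
def symGrad (u : H1per) (y : Fin 3 → ℝ) : Matrix (Fin 3) (Fin 3) ℂ :=
  Matrix.of fun i j => (grad u y (i, j) + grad u y (j, i)) / 2

/-- `i X_χ c = i sym (c χᵀ)` for a vector `c`. -/
def iX (χ : EuclideanSpace ℝ (Fin 3)) (c : Vec) : Matrix (Fin 3) (Fin 3) ℂ :=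
  Matrix.of fun i j => Complex.I * ((c i * (χ j : ℂ) + c j * (χ i : ℂ)) / 2)

/-- `i X_χ u` for a function `u`. -/
def iXf (χ : EuclideanSpace ℝ (Fin 3)) (u : H1per) (y : Fin 3 → ℝ) :
    Matrix (Fin 3) (Fin 3) ℂ := iX χ (val u y)

/-- A field of fourth-order tensors; `A y i j k l` is the coefficient (often written with upper
indices `i, k` and lower indices `j, l`) with `(A B)_{ij} = ∑_{k,l} A_{ijkl} B_{kl}`. -/
abbrev TensorField : Type := (Fin 3 → ℝ) → Fin 3 → Fin 3 → Fin 3 → Fin 3 → ℝ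

/-- The standing assumptions on the tensor of material coefficients, with ellipticity
constant `ν`. -/
structure IsCoefficient (A : TensorField) (ν : ℝ) : Prop where
  pos : 0 < ν
  periodic : ∀ y m, A (y + Pi.single m 1) = A y
  lower : ∀ y ∈ cell, ∀ ξ : Matrix (Fin 3) (Fin 3) ℝ, ξ.IsSymm →
    ν * ∑ i, ∑ j, ξ i j ^ 2 ≤ ∑ i, ∑ j, (∑ k, ∑ l, A y i j k l * ξ k l) * ξ i j
  upper : ∀ y ∈ cell, ∀ ξ : Matrix (Fin 3) (Fin 3) ℝ, ξ.IsSymm →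
    ∑ i, ∑ j, (∑ k, ∑ l, A y i j k l * ξ k l) * ξ i j ≤ 1 / ν * ∑ i, ∑ j, ξ i j ^ 2
  minor_symm : ∀ y i j k l, A y i j k l = A y j i k l
  major_symm : ∀ y i j k l, A y i j k l = A y k l i j
  bounded : ∀ i j k l, MemLp (fun y => A y i j k l) ⊤ (volume.restrict cell)

/-- `∫_Y A E : conj F = ∫_Y ∑_{ij} (A E)_{ij} conj F_{ij}`. -/
def tensorForm (A : TensorField) (E F : (Fin 3 → ℝ) → Matrix (Fin 3) (Fin 3) ℂ) : ℂ :=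
  ∫ y in cell, ∑ i, ∑ j, (∑ k, ∑ l, (A y i j k l : ℂ) * E y k l) * conj (F y i j)

/-- `∫_Y g · conj h`. -/
def l2pair (g h : (Fin 3 → ℝ) → Vec) : ℂ := ∫ y in cell, ∑ i, g y i * conj (h y i)

/-- `‖sym ∇u‖_{L²(Y)}`, with the Frobenius norm. -/
def symGradNorm (u : H1per) : ℝ :=
  Real.sqrt (∫ y in cell, ∑ i, ∑ j, ‖symGrad u y i j‖ ^ 2)

/-- `K` is an admissible constant in Korn's inequality for mean-zero periodic functions. -/
def IsKornConstant (K : ℝ) : Prop :=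
  0 < K ∧ ∀ u : H1per, mean u = 0 → ‖u‖ ≤ K * symGradNorm u

/-- `u` solves the `χ`-dependent cell problem for `c ∈ ℂ³`. -/
def IsCellCorrector (A : TensorField) (χ : EuclideanSpace ℝ (Fin 3)) (c : Vec) (u : H1per) :
    Prop :=
  (∀ v : H1per, tensorForm A (fun y => symGrad u y + iX χ c) (symGrad v) = 0) ∧ mean u = 0

/-- The solution of the `χ`-dependent cell problem. -/
def cellCorrector (A : TensorField) (χ : EuclideanSpace ℝ (Fin 3)) (c : Vec) : H1per :=
  Classical.epsilon (IsCellCorrector A χ c)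

/-- The homogenized matrix `A_χ^hom`: its `(i,j)` entry is
`⟨A_χ^hom e_j, e_i⟩ = ∫_Y A (sym ∇u_{e_j} + i X_χ e_j) : conj (i X_χ e_i)`. -/
def homMatrix (A : TensorField) (χ : EuclideanSpace ℝ (Fin 3)) : Matrix (Fin 3) (Fin 3) ℂ :=
  Matrix.of fun i j =>
    tensorForm A
      (fun y => symGrad (cellCorrector A χ (EuclideanSpace.single j 1)) y
        + iX χ (EuclideanSpace.single j 1))
      (fun _ => iX χ (EuclideanSpace.single i 1))

/-- `|χ|⁻² A_χ^hom`. -/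
def scaledHom (A : TensorField) (χ : EuclideanSpace ℝ (Fin 3)) : Matrix (Fin 3) (Fin 3) ℂ :=
  ((1 / ‖χ‖ ^ 2 : ℝ) : ℂ) • homMatrix A χ

/-- `D_χ^hom(z) = dist (z, σ(|χ|⁻² A_χ^hom))`. -/
def homDist (A : TensorField) (χ : EuclideanSpace ℝ (Fin 3)) (z : ℂ) : ℝ :=
  Metric.infDist z (spectrum ℂ (scaledHom A χ))

/-- The system of equations for one cycle `(u₀, u₁, u₂)`.  The terms of earlier cycles that enter
are `p₁ = u₁^{(n-1)}`, `p₂ = u₂^{(n-1)}`, `q₂ = u₂^{(n-2)}`, and `g` is the datum that enters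
(`f` in cycle `0`, zero afterwards). In the last equation, the constant `u₀` is identified with its
mean. -/
structure CycleEqs (A : TensorField) (χ : EuclideanSpace ℝ (Fin 3)) (z : ℂ)
    (g : L2Vec) (p₁ p₂ q₂ : H1per) (u₀ u₁ u₂ : H1per) : Prop where
  eq_zero : ∀ v : H1per, tensorForm A (symGrad u₀) (symGrad v) = 0
  eq_one : ∀ v : H1per,
    tensorForm A (symGrad u₁) (symGrad v) = - tensorForm A (iXf χ u₀) (symGrad v)
  mean_one : mean u₁ = 0
  eq_two : ∀ v : H1per,
    tensorForm A (symGrad u₂) (symGrad v) =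
      - tensorForm A (iXf χ (u₁ + p₂)) (symGrad v)
      - tensorForm A (symGrad (u₁ + p₂)) (iXf χ v)
      - tensorForm A (iXf χ (u₀ + p₁ + q₂)) (iXf χ v)
      + z * (‖χ‖ : ℂ) ^ 2 * l2pair (val (u₀ + p₁ + q₂)) (val v)
      + (‖χ‖ : ℂ) ^ 2 * l2pair g (val v)
  mean_two : mean u₂ = 0
  eq_hom : ∀ d : Vec,
    ∑ i, (scaledHom A χ).mulVec (mean u₀) i * conj (d i) - z * l2pair (val u₀) (fun _ => d) =
      - (((1 / ‖χ‖ ^ 2 : ℝ) : ℂ) *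
          tensorForm A (fun y => symGrad p₂ y + iXf χ (p₁ + q₂) y) (fun _ => iX χ d))
      + l2pair g (fun _ => d)

/-- `u n j` is the term `u_j^{(n)}` of the asymptotic procedure for the datum `f`. -/
structure IsCycleTerms (A : TensorField) (χ : EuclideanSpace ℝ (Fin 3)) (z : ℂ) (f : L2Vec)
    (u : ℕ → Fin 3 → H1per) : Prop where
  cycle_zero : CycleEqs A χ z f 0 0 0 (u 0 0) (u 0 1) (u 0 2)
  cycle_one : CycleEqs A χ z 0 (u 0 1) (u 0 2) 0 (u 1 0) (u 1 1) (u 1 2)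
  cycle_succ : ∀ n, CycleEqs A χ z 0 (u (n + 1) 1) (u (n + 1) 2) (u n 2)
    (u (n + 2) 0) (u (n + 2) 1) (u (n + 2) 2)

def const0 (ν : ℝ) : ℝ := max (3 / ν) 1

def const1 (ν K : ℝ) : ℝ := max (max (3 * K / ν ^ 3) (K / ν ^ 2)) 1

def const2 (ν K : ℝ) : ℝ :=
  max (4 * K ^ 2 / ν ^ 2 * const1 ν K + 6 * K ^ 2 / ν * max 1 (1 / ν) * const0 ν) 1

/-- The constant `C = max {C₀, C₁, C₂}`, explicit in `ν` and the Korn constant `K`. -/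
def fibreConst (ν K : ℝ) : ℝ := max (max (const0 ν) (const1 ν K)) (const2 ν K)

end Fibre

end

namespace Fibre

/-! ### Smooth periodic functions -/

/-! Everything rests on one estimate on `H1per`, `‖u‖² ≤ 2‖mean u‖² + 14‖sym ∇u‖²`
(`norm_sq_le_mean_add_symGradL`). For smooth periodic φ it combines a Poincaré inequality, obtained
by averaging φ(y + h) − φ(y) over all shifts h in the cell, with the identity 2|sym G|² = |G|² + Re
∑ G_ij conj G_ji for G = ∇φ, whose cross term integrates to ∫ |div φ|² ≥ 0. Both sides are
continuous in (u, ∇u), so the estimate passes to the closure. It contains Korn's inequality and,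
with ellipticity, makes the elliptic problem uniquely solvable among mean-zero functions for every
load that annihilates constants (`exists_solution`, `eq_of_inner_eq`).

One cycle is a triangular system. Its first equation forces u₀ to be constant. Its last equation
determines that constant, because z lies in the resolvent set of |χ|⁻² A_χ^hom. Then u₁ is the cell
corrector of u₀. The last equation also says precisely that the load of u₂ annihilates constants
(`inner_load_constH`), so u₂ exists. The whole family follows by a recursion that remembers two
cycles.

For the estimates each elliptic equation is tested with its own solution. The coefficient tensor has
norm at most 1/ν on all complex matrices (`IsCoefficient.norm_tensorCLM_le`), each X_χ contributes a
factor |χ|, and A_χ^hom is Hermitian, being a Gram matrix of corrected fields, so solving for u₀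
costs 1/D (`infDist_spectrum_mul_norm_le`). A cycle thus costs a factor C|χ|, a division by D
through u₀ and a multiplication by |z| through u₂; these last two operations are index shifts in the
double geometric sum (`geomSum₂_le_mul`, `mul_geomSum₂_le`). `CycleEqs.bounds` carries out one
cycle, and an induction over pairs of consecutive cycles gives all n. -/

lemma cell_eq_fundamentalDomain :
    cell = ZSpan.fundamentalDomain (Pi.basisFun ℝ (Fin 3)) := by
  rw [ZSpan.fundamentalDomain_pi_basisFun]; rfl

lemma measurableSet_cell : MeasurableSet cell :=
  MeasurableSet.univ_pi fun _ => measurableSet_Ico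

lemma volume_cell : volume cell = 1 := by
  simp [cell, volume_pi_pi]

instance : IsProbabilityMeasure (volume.restrict cell) :=
  ⟨by rw [Measure.restrict_apply_univ, volume_cell]⟩

lemma cell_subset_Icc : cell ⊆ Set.Icc 0 1 := fun _ hy =>
  ⟨fun i => (hy i trivial).1, fun i => (hy i trivial).2.le⟩

lemma cell_ae_eq_Icc : cell =ᵐ[volume] Set.Icc (0 : Fin 3 → ℝ) 1 :=
  Measure.univ_pi_Ico_ae_eq_Icc

lemma _root_.Continuous.integrable_cell {E : Type*} [NormedAddCommGroup E]
    {g : (Fin 3 → ℝ) → E} (hg : Continuous g) : Integrable g (volume.restrict cell) :=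
  (hg.integrableOn_Icc (a := 0) (b := 1)).mono_set cell_subset_Icc

lemma _root_.Continuous.integrable_cell_prod {X E : Type*} [NormedAddCommGroup E]
    [TopologicalSpace X] [MeasurableSpace X] [OpensMeasurableSpace X] [SecondCountableTopology X] [T2Space X]
    {g : (Fin 3 → ℝ) × X → E} (hg : Continuous g) {s t : Set X} (hs : IsCompact s) (hst : t ⊆ s)
    {μ : Measure X} [IsLocallyFiniteMeasure μ] [SFinite μ] :
    Integrable g ((volume.restrict cell).prod (μ.restrict t)) := by
  rw [Measure.prod_restrict]
  exact IntegrableOn.mono_set (hg.continuousOn.integrableOn_compact (isCompact_Icc.prod hs))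
    (Set.prod_mono cell_subset_Icc hst)

open scoped Pointwise in
/-- The integral over the cell of a periodic function is translation invariant. -/
lemma integral_cell_add {E : Type*} [NormedAddCommGroup E] [NormedSpace ℝ E]
    {g : (Fin 3 → ℝ) → E} (hper : ∀ x j, g (x + Pi.single j 1) = g x) (h : Fin 3 → ℝ) :
    ∫ y in cell, g (y + h) = ∫ y in cell, g y := by
  have hinv : ∀ v ∈ (Submodule.span ℤ (Set.range (Pi.basisFun ℝ (Fin 3)))), ∀ x,
      g (v + x) = g x := by
    intro v hv
    induction hv using Submodule.span_induction with
    | mem v hv =>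
      obtain ⟨j, rfl⟩ := hv
      intro x
      rw [Pi.basisFun_apply, add_comm, hper]
    | zero => simp
    | add v w _ _ hv hw => intro x; rw [add_assoc, hv, hw]
    | smul n v _ hv =>
      intro x
      induction n generalizing x with
      | zero => simp
      | succ n ih => rw [add_smul, one_smul, add_assoc, ih, hv]
      | pred n ih =>
        rw [← hv, ← ih x]
        congr 1
        module
  have hD := ZSpan.isAddFundamentalDomain' (Pi.basisFun ℝ (Fin 3)) volume
  rw [← cell_eq_fundamentalDomain] at hD
  have : Countable (Submodule.span ℤ (Set.range (Pi.basisFun ℝ (Fin 3)))).toAddSubgroup :=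
    inferInstanceAs (Countable (Submodule.span ℤ (Set.range (Pi.basisFun ℝ (Fin 3)))))
  have hD' := hD.vadd_of_comm h
  have key := hD.setIntegral_eq hD' (f := g) fun v x => hinv v v.2 x
  calc ∫ y in cell, g (y + h) = ∫ y in (fun y => y + h) ⁻¹' (h +ᵥ cell), g (y + h) := by
        congr 2
        ext y
        simp [Set.mem_vadd_set_iff_neg_vadd_mem, add_comm]
    _ = ∫ y in h +ᵥ cell, g y :=
        (measurePreserving_add_right volume h).setIntegral_preimage_emb
          (measurableEmbedding_addRight h) g _
    _ = ∫ y in cell, g y := key.symm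

/-- The integral over the cell of a partial derivative of a periodic function vanishes. -/
lemma integral_cell_fderiv {g : (Fin 3 → ℝ) → ℂ} (hg : ContDiff ℝ 1 g)
    (hper : ∀ x j, g (x + Pi.single j 1) = g x) (k : Fin 3) :
    ∫ y in cell, fderiv ℝ g y (Pi.single k 1) = 0 := by
  rw [setIntegral_congr_set cell_ae_eq_Icc]
  have hc : Continuous (fderiv ℝ g) := hg.continuous_fderiv one_ne_zero
  have := integral_divergence_of_hasFDerivAt_off_countable' (0 : Fin 3 → ℝ) 1
    (fun _ => zero_le_one) (fun i => if i = k then g else 0)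
    (fun i x => if i = k then fderiv ℝ g x else 0) ∅ Set.countable_empty
    (fun i => by split_ifs <;> [exact hg.continuous.continuousOn; exact continuousOn_const])
    (fun x _ i => by
      split_ifs
      · exact (hg.differentiable one_ne_zero x).hasFDerivAt
      · exact hasFDerivAt_const 0 x)
    (by
      apply Continuous.integrableOn_Icc
      refine continuous_finsetSum _ fun i _ => ?_
      split_ifs <;> fun_prop)
  have hl : ∀ x, ∑ i, (if i = k then fderiv ℝ g x else 0) (Pi.single i 1)
      = fderiv ℝ g x (Pi.single k 1) := fun x => by
    rw [Finset.sum_eq_single k] <;> simp +contextual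
  simp only [hl] at this
  rw [this, Finset.sum_eq_single k (fun i _ hi => by simp [hi]) (by simp), sub_eq_zero]
  congr 1
  ext x
  simp only [if_true]
  -- Only the two faces orthogonal to the direction k contribute, and periodicity identifies them.
  rw [← hper (k.insertNth ((0 : Fin 3 → ℝ) k) x) k]
  congr 1
  ext i
  refine Fin.succAboveCases k ?_ (fun i => ?_) i <;> simp [Fin.succAbove_ne]

/-! ### The Poincaré inequality for smooth periodic functions. -/

lemma norm_integral_sq_le {Ω E : Type*} [MeasurableSpace Ω] [NormedAddCommGroup E]
    [NormedSpace ℝ E] {μ : Measure Ω} [IsProbabilityMeasure μ] {g : Ω → E}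
    (hg : Integrable g μ) (hg2 : Integrable (fun x => ‖g x‖ ^ 2) μ) :
    ‖∫ x, g x ∂μ‖ ^ 2 ≤ ∫ x, ‖g x‖ ^ 2 ∂μ := by
  have h1 := (even_two.convexOn_pow (𝕜 := ℝ)).map_integral_le (μ := μ) (f := fun x => ‖g x‖)
    (continuous_pow 2).continuousOn isClosed_univ (by simp) hg.norm hg2
  exact (pow_le_pow_left₀ (norm_nonneg _) (norm_integral_le_integral_norm g) 2).trans h1

lemma norm_sq_apply_le (L : (Fin 3 → ℝ) →L[ℝ] Vec) {h : Fin 3 → ℝ} (hh : h ∈ cell) :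
    ‖L h‖ ^ 2 ≤ 3 * ∑ i, ∑ j, ‖L (Pi.single j 1) i‖ ^ 2 := by
  have hL : L h = ∑ j, h j • L (Pi.single j 1) := by
    conv_lhs => rw [pi_eq_sum_univ' h]
    simp [map_sum]
  have h1 : ‖L h‖ ≤ ∑ j, ‖L (Pi.single j 1)‖ := by
    rw [hL]
    refine (norm_sum_le _ _).trans (Finset.sum_le_sum fun j _ => ?_)
    rw [norm_smul, Real.norm_of_nonneg (hh j trivial).1]
    exact mul_le_of_le_one_left (norm_nonneg _) (hh j trivial).2.le
  calc ‖L h‖ ^ 2 ≤ (∑ j, ‖L (Pi.single j 1)‖) ^ 2 := by gcongr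
    _ ≤ 3 * ∑ j, ‖L (Pi.single j 1)‖ ^ 2 := by
        simpa using sq_sum_le_card_mul_sum_sq (s := Finset.univ)
          (f := fun j => ‖L (Pi.single j 1)‖)
    _ = _ := by simp_rw [EuclideanSpace.norm_sq_eq]; rw [Finset.sum_comm]

section Smooth

variable {φ : (Fin 3 → ℝ) → Vec} (hφ : ContDiff ℝ ∞ φ)
  (hper : ∀ x j, φ (x + Pi.single j 1) = φ x)

include hper in
lemma fderiv_periodic (x : Fin 3 → ℝ) (j : Fin 3) :
    fderiv ℝ φ (x + Pi.single j 1) = fderiv ℝ φ x := by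
  rw [← fderiv_comp_add_right]
  simp_rw [hper]

include hφ in
lemma continuous_fderiv_of_smooth : Continuous (fderiv ℝ φ) :=
  hφ.continuous_fderiv (by simp)

include hφ hper in
-- The difference is the integral of the derivative along the segment from y to y + h. After Jensen
-- and Fubini, translation invariance removes the shift t • h, leaving ∫ |∇φ · h|², to which
-- `norm_sq_apply_le` applies.
lemma integral_shift_sub_sq_le {h : Fin 3 → ℝ} (hh : h ∈ cell) :
    ∫ y in cell, ‖φ (y + h) - φ y‖ ^ 2 ≤
      3 * ∫ y in cell, ∑ i, ∑ j, ‖fderiv ℝ φ y (Pi.single j 1) i‖ ^ 2 := by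
  have hc := continuous_fderiv_of_smooth hφ
  have hφc := hφ.continuous
  have hprob : IsProbabilityMeasure (volume.restrict (Set.Ioc (0 : ℝ) 1)) :=
    ⟨by simp⟩
  have hpt : ∀ y, ‖φ (y + h) - φ y‖ ^ 2 ≤
      ∫ t in Set.Ioc (0 : ℝ) 1, ‖fderiv ℝ φ (y + t • h) h‖ ^ 2 := by
    intro y
    have hcont : Continuous fun t : ℝ => fderiv ℝ φ (y + t • h) h := by fun_prop
    have hd : ∀ t ∈ Set.uIcc (0 : ℝ) 1,
        HasDerivAt (fun t : ℝ => φ (y + t • h)) (fderiv ℝ φ (y + t • h) h) t := fun t _ => by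
      have h1 : HasDerivAt (fun t : ℝ => y + t • h) h t := by
        simpa using ((hasDerivAt_id t).smul_const h).const_add y
      exact ((hφ.differentiable (by simp) _).hasFDerivAt).comp_hasDerivAt t h1
    have h2 := intervalIntegral.integral_eq_sub_of_hasDerivAt hd (hcont.intervalIntegrable 0 1)
    rw [intervalIntegral.integral_of_le zero_le_one] at h2
    simp only [one_smul, zero_smul, add_zero] at h2
    rw [← h2]
    exact norm_integral_sq_le (hcont.integrableOn_Ioc) ((hcont.norm.pow 2).integrableOn_Ioc)
  have hjoint : Continuous fun p : (Fin 3 → ℝ) × ℝ => ‖fderiv ℝ φ (p.1 + p.2 • h) h‖ ^ 2 := by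
    fun_prop
  have hint := hjoint.integrable_cell_prod (isCompact_Icc (a := (0 : ℝ)) (b := 1))
    Set.Ioc_subset_Icc_self (μ := volume)
  calc ∫ y in cell, ‖φ (y + h) - φ y‖ ^ 2
      ≤ ∫ y in cell, ∫ t in Set.Ioc (0 : ℝ) 1, ‖fderiv ℝ φ (y + t • h) h‖ ^ 2 := by
        refine integral_mono (Continuous.integrable_cell (by fun_prop)) hint.integral_prod_left hpt
    _ = ∫ t in Set.Ioc (0 : ℝ) 1, ∫ y in cell, ‖fderiv ℝ φ (y + t • h) h‖ ^ 2 :=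
        integral_integral_swap hint
    _ = ∫ t in Set.Ioc (0 : ℝ) 1, ∫ y in cell, ‖fderiv ℝ φ y h‖ ^ 2 := by
        congr 1
        ext t
        exact integral_cell_add (g := fun y => ‖fderiv ℝ φ y h‖ ^ 2)
          (fun x j => by simp only [fderiv_periodic hper]) (t • h)
    _ = ∫ y in cell, ‖fderiv ℝ φ y h‖ ^ 2 := by simp
    _ ≤ ∫ y in cell, 3 * ∑ i, ∑ j, ‖fderiv ℝ φ y (Pi.single j 1) i‖ ^ 2 := by
        refine integral_mono (Continuous.integrable_cell (by fun_prop))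
          (Continuous.integrable_cell (by fun_prop)) fun y => norm_sq_apply_le _ hh
    _ = _ := integral_const_mul _ _

include hφ hper in
/-- The Poincaré inequality for smooth periodic functions. -/
lemma poincare_smooth :
    ∫ y in cell, ‖φ y‖ ^ 2 ≤ 2 * ‖∫ y in cell, φ y‖ ^ 2 +
      6 * ∫ y in cell, ∑ i, ∑ j, ‖fderiv ℝ φ y (Pi.single j 1) i‖ ^ 2 := by
  have hφc := hφ.continuous
  set m := ∫ y in cell, φ y with hm
  set G := ∫ y in cell, ∑ i, ∑ j, ‖fderiv ℝ φ y (Pi.single j 1) i‖ ^ 2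
  -- By periodicity m is the average of φ(y + h) over h for every fixed y, so m − φ(y) is an average
  -- of differences and Jensen applies.
  have hpt : ∀ y, ‖φ y - m‖ ^ 2 ≤ ∫ h in cell, ‖φ (y + h) - φ y‖ ^ 2 := by
    intro y
    have h1 : ∫ h in cell, (φ (y + h) - φ y) = m - φ y := by
      rw [integral_sub (Continuous.integrable_cell (by fun_prop)) (integrable_const _)]
      simp only [integral_const, probReal_univ, one_smul]
      simp_rw [add_comm y, integral_cell_add hper y, hm]
    rw [norm_sub_rev, ← h1]
    exact norm_integral_sq_le (Continuous.integrable_cell (by fun_prop))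
      (Continuous.integrable_cell (by fun_prop))
  have hjoint : Continuous fun p : (Fin 3 → ℝ) × (Fin 3 → ℝ) => ‖φ (p.1 + p.2) - φ p.1‖ ^ 2 := by
    fun_prop
  have hint := hjoint.integrable_cell_prod (isCompact_Icc (a := (0 : Fin 3 → ℝ)) (b := 1))
    cell_subset_Icc (μ := volume)
  have h2 : ∫ y in cell, ‖φ y - m‖ ^ 2 ≤ 3 * G :=
    calc ∫ y in cell, ‖φ y - m‖ ^ 2
        ≤ ∫ y in cell, ∫ h in cell, ‖φ (y + h) - φ y‖ ^ 2 :=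
          integral_mono (Continuous.integrable_cell (by fun_prop)) hint.integral_prod_left hpt
      _ = ∫ h in cell, ∫ y in cell, ‖φ (y + h) - φ y‖ ^ 2 := integral_integral_swap hint
      _ ≤ ∫ h in cell, 3 * G := by
          refine setIntegral_mono_on hint.integral_prod_right (integrable_const _)
            measurableSet_cell fun h hh => integral_shift_sub_sq_le hφ hper hh
      _ = 3 * G := by simp
  calc ∫ y in cell, ‖φ y‖ ^ 2 ≤ ∫ y in cell, (2 * ‖m‖ ^ 2 + 2 * ‖φ y - m‖ ^ 2) := by
        refine integral_mono (Continuous.integrable_cell (by fun_prop))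
          (Continuous.integrable_cell (by fun_prop)) fun y => ?_
        have := norm_add_le m (φ y - m)
        rw [add_sub_cancel] at this
        nlinarith [sq_nonneg (‖m‖ - ‖φ y - m‖), norm_nonneg (φ y), norm_nonneg m,
          norm_nonneg (φ y - m)]
    _ = 2 * ‖m‖ ^ 2 + 2 * ∫ y in cell, ‖φ y - m‖ ^ 2 := by
        rw [integral_add (integrable_const _) (Continuous.integrable_cell (by fun_prop))]
        simp [integral_const_mul]
    _ ≤ _ := by linarith

end Smooth

/-! ### Integration by parts and Korn's inequality for smooth functions. -/

lemma two_le_infty : (1 + 1 : WithTop ℕ∞) ≤ ∞ := by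
  rw [one_add_one_eq_two]
  exact WithTop.coe_le_coe.2 (le_top (a := (2 : ℕ∞)))

lemma fderiv_mul_conj {a b : (Fin 3 → ℝ) → ℂ} {y : Fin 3 → ℝ} (ha : DifferentiableAt ℝ a y)
    (hb : DifferentiableAt ℝ b y) (v : Fin 3 → ℝ) :
    fderiv ℝ (fun y => a y * conj (b y)) y v =
      fderiv ℝ a y v * conj (b y) + a y * conj (fderiv ℝ b y v) := by
  have h := ha.hasFDerivAt.mul
    ((Complex.conjCLE.toContinuousLinearMap.hasFDerivAt (x := b y)).comp y hb.hasFDerivAt)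
  have h' : HasFDerivAt (fun y => a y * conj (b y)) _ y := h
  rw [h'.fderiv]
  simp
  ring

section Smooth

variable {φ : (Fin 3 → ℝ) → Vec} (hφ : ContDiff ℝ ∞ φ)
  (hper : ∀ x j, φ (x + Pi.single j 1) = φ x)

include hφ in
lemma fderiv_component (i : Fin 3) (y v : Fin 3 → ℝ) :
    fderiv ℝ (fun y => φ y i) y v = fderiv ℝ φ y v i := by
  have h : HasFDerivAt (fun y => φ y i) _ y :=
    ((EuclideanSpace.proj (𝕜 := ℂ) i).restrictScalars ℝ).hasFDerivAt.comp y
      (hφ.differentiable (by simp) y).hasFDerivAt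
  rw [h.fderiv]
  rfl

include hφ in
lemma contDiff_fderiv_component (v : Fin 3 → ℝ) (i : Fin 3) :
    ContDiff ℝ 1 (fun y => fderiv ℝ φ y v i) := by
  have h1 : ContDiff ℝ 1 (fderiv ℝ φ) := hφ.fderiv_right two_le_infty
  have h2 : ContDiff ℝ 1 (fun y => fderiv ℝ φ y v) := h1.clm_apply contDiff_const
  exact ((EuclideanSpace.proj (𝕜 := ℂ) i).restrictScalars ℝ).contDiff.comp h2

include hφ in
lemma fderiv_fderiv_component_comm (v w y : Fin 3 → ℝ) (i : Fin 3) :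
    fderiv ℝ (fun y => fderiv ℝ φ y v i) y w = fderiv ℝ (fun y => fderiv ℝ φ y w i) y v := by
  have hd : DifferentiableAt ℝ (fderiv ℝ φ) y :=
    ((hφ.fderiv_right (m := 1) two_le_infty).differentiable one_ne_zero) y
  have key : ∀ v w, fderiv ℝ (fun y => fderiv ℝ φ y v i) y w
      = fderiv ℝ (fderiv ℝ φ) y w v i := fun v w => by
    have h1 : HasFDerivAt (fun y => fderiv ℝ φ y v) _ y :=
      hd.hasFDerivAt.clm_apply (hasFDerivAt_const v y)
    have h : HasFDerivAt (fun y => fderiv ℝ φ y v i) _ y :=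
      ((EuclideanSpace.proj (𝕜 := ℂ) i).restrictScalars ℝ).hasFDerivAt.comp y h1
    rw [h.fderiv]
    simp
  have hs : IsSymmSndFDerivAt ℝ φ y := hφ.contDiffAt.isSymmSndFDerivAt (by simpa [one_add_one_eq_two] using two_le_infty)
  rw [key, key, hs.eq]

include hφ hper in
-- Two integrations by parts: the integrands differ by ∂_j(φ_i conj ∂_iφ_j) − ∂_i(φ_i conj ∂_jφ_j),
-- in which the second-order terms cancel, and both derivatives have integral zero.
lemma integral_fderiv_mul_conj_symm (i j : Fin 3) :
    ∫ y in cell, fderiv ℝ φ y (Pi.single j 1) i * conj (fderiv ℝ φ y (Pi.single i 1) j) =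
      ∫ y in cell, fderiv ℝ φ y (Pi.single i 1) i * conj (fderiv ℝ φ y (Pi.single j 1) j) := by
  have hφi : ContDiff ℝ 1 fun y => φ y i :=
    ((EuclideanSpace.proj (𝕜 := ℂ) i).restrictScalars ℝ).contDiff.comp
      (hφ.of_le (by exact_mod_cast le_top))
  have hD := fun v => contDiff_fderiv_component hφ v j
  have hcj : ∀ v, ContDiff ℝ 1 fun y => conj (fderiv ℝ φ y v j) := fun v =>
    Complex.conjCLE.toContinuousLinearMap.contDiff.comp (hD v)
  have hz : ∀ v k, ∫ y in cell,
      fderiv ℝ (fun y => φ y i * conj (fderiv ℝ φ y v j)) y (Pi.single k 1) = 0 := fun v k =>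
    integral_cell_fderiv (hφi.mul (hcj v))
      (fun x l => by simp only [hper, fderiv_periodic hper]) k
  have hc : ∀ v k, Continuous fun y =>
      fderiv ℝ (fun y => φ y i * conj (fderiv ℝ φ y v j)) y (Pi.single k 1) := fun v k =>
    ((hφi.mul (hcj v)).continuous_fderiv one_ne_zero).clm_apply continuous_const
  have hcont := continuous_fderiv_of_smooth hφ
  rw [← sub_eq_zero, ← integral_sub (Continuous.integrable_cell (by fun_prop))
    (Continuous.integrable_cell (by fun_prop))]
  rw [← sub_eq_zero.2 ((hz (Pi.single i 1) j).trans (hz (Pi.single j 1) i).symm),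
    ← integral_sub (hc _ _).integrable_cell (hc _ _).integrable_cell]
  congr 1
  ext y
  rw [fderiv_mul_conj (hφi.differentiable one_ne_zero y) ((hD _).differentiable one_ne_zero y),
    fderiv_mul_conj (hφi.differentiable one_ne_zero y) ((hD _).differentiable one_ne_zero y),
    fderiv_component hφ, fderiv_component hφ, fderiv_fderiv_component_comm hφ]
  ring

include hφ hper in
/-- Korn's inequality between gradients for smooth periodic functions. -/
lemma korn_smooth :
    ∫ y in cell, ∑ i, ∑ j, ‖fderiv ℝ φ y (Pi.single j 1) i‖ ^ 2 ≤
      2 * ∫ y in cell, ∑ i, ∑ j, ‖(fderiv ℝ φ y (Pi.single j 1) i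
        + fderiv ℝ φ y (Pi.single i 1) j) / 2‖ ^ 2 := by
  have hc := continuous_fderiv_of_smooth hφ
  have hpt : ∀ y, 2 * ∑ i, ∑ j, ‖(fderiv ℝ φ y (Pi.single j 1) i
        + fderiv ℝ φ y (Pi.single i 1) j) / 2‖ ^ 2 =
      ∑ i, ∑ j, ‖fderiv ℝ φ y (Pi.single j 1) i‖ ^ 2 +
      (∑ i, ∑ j, fderiv ℝ φ y (Pi.single j 1) i * conj (fderiv ℝ φ y (Pi.single i 1) j)).re := by
    intro y
    simp only [Fin.sum_univ_three, ← Complex.normSq_eq_norm_sq, Complex.normSq_apply,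
      Complex.add_re, Complex.mul_re, Complex.conj_re, Complex.conj_im, Complex.div_ofNat_re,
      Complex.div_ofNat_im, Complex.add_im]
    ring
  -- Integration by parts turns the cross term into ∫ |div φ|².
  have hdiv : 0 ≤ ∫ y in cell,
      (∑ i, ∑ j, fderiv ℝ φ y (Pi.single j 1) i * conj (fderiv ℝ φ y (Pi.single i 1) j)).re := by
    have h1 : ∫ y in cell,
        ∑ i, ∑ j, fderiv ℝ φ y (Pi.single j 1) i * conj (fderiv ℝ φ y (Pi.single i 1) j) =
        ∫ y in cell,
        ∑ i, ∑ j, fderiv ℝ φ y (Pi.single i 1) i * conj (fderiv ℝ φ y (Pi.single j 1) j) := by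
      rw [integral_finsetSum _ fun i _ => Continuous.integrable_cell (by fun_prop),
        integral_finsetSum _ fun i _ => Continuous.integrable_cell (by fun_prop)]
      refine Finset.sum_congr rfl fun i _ => ?_
      rw [integral_finsetSum _ fun i _ => Continuous.integrable_cell (by fun_prop),
        integral_finsetSum _ fun i _ => Continuous.integrable_cell (by fun_prop)]
      exact Finset.sum_congr rfl fun j _ => integral_fderiv_mul_conj_symm hφ hper i j
    have hre : ∀ {g : (Fin 3 → ℝ) → ℂ}, Continuous g →
        ∫ y in cell, (g y).re = (∫ y in cell, g y).re := fun hg =>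
      integral_re hg.integrable_cell
    rw [hre (by fun_prop), h1, ← hre (by fun_prop)]
    refine integral_nonneg fun y => ?_
    rw [← Finset.sum_mul_sum, ← map_sum, Complex.mul_conj]
    exact_mod_cast Complex.normSq_nonneg _
  have hcre : Continuous fun y => (∑ i, ∑ j,
      fderiv ℝ φ y (Pi.single j 1) i * conj (fderiv ℝ φ y (Pi.single i 1) j)).re :=
    Complex.continuous_re.comp (by fun_prop)
  rw [← integral_const_mul]
  simp_rw [hpt]
  rw [integral_add (Continuous.integrable_cell (by fun_prop))
    (Continuous.integrable_cell hcre)]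
  linarith

end Smooth

/-! ### Pointwise operators -/

/-- A fourth-order tensor as a matrix acting on `ℝ^{3×3}`. -/
def tensorMatrix (a : Fin 3 → Fin 3 → Fin 3 → Fin 3 → ℝ) :
    Matrix (Fin 3 × Fin 3) (Fin 3 × Fin 3) ℝ :=
  Matrix.of fun p q => a p.1 p.2 q.1 q.2

lemma IsCoefficient.isSymm {A : TensorField} {ν : ℝ} (hA : IsCoefficient A ν)
    (y : Fin 3 → ℝ) : (tensorMatrix (A y)).IsSymm := by
  ext p q
  exact hA.major_symm y q.1 q.2 p.1 p.2

lemma dotProduct_mulVec_tensorMatrix (a : Fin 3 → Fin 3 → Fin 3 → Fin 3 → ℝ)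
    (X Y : Fin 3 × Fin 3 → ℝ) :
    (tensorMatrix a).mulVec X ⬝ᵥ Y =
      ∑ i, ∑ j, (∑ k, ∑ l, a i j k l * X (k, l)) * Y (i, j) := by
  simp [dotProduct, Matrix.mulVec, Fintype.sum_prod_type, tensorMatrix]

lemma dotProduct_self_eq (X : Fin 3 × Fin 3 → ℝ) : X ⬝ᵥ X = ∑ i, ∑ j, X (i, j) ^ 2 := by
  simp [dotProduct, Fintype.sum_prod_type, pow_two]

section Pointwise

variable {A : TensorField} {ν : ℝ} (hA : IsCoefficient A ν) {y : Fin 3 → ℝ} (hy : y ∈ cell)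

include hA hy in
lemma IsCoefficient.le_dotProduct {X : Fin 3 × Fin 3 → ℝ} (hX : ∀ p, X p.swap = X p) :
    ν * (X ⬝ᵥ X) ≤ (tensorMatrix (A y)).mulVec X ⬝ᵥ X := by
  rw [dotProduct_mulVec_tensorMatrix, dotProduct_self_eq]
  exact hA.lower y hy (Matrix.of fun i j => X (i, j)) (by ext i j; exact hX (i, j))

include hA hy in
lemma IsCoefficient.dotProduct_le {X : Fin 3 × Fin 3 → ℝ} (hX : ∀ p, X p.swap = X p) :
    (tensorMatrix (A y)).mulVec X ⬝ᵥ X ≤ 1 / ν * (X ⬝ᵥ X) := by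
  rw [dotProduct_mulVec_tensorMatrix, dotProduct_self_eq]
  exact hA.upper y hy (Matrix.of fun i j => X (i, j)) (by ext i j; exact hX (i, j))

include hA hy in
lemma IsCoefficient.ellipticity_le_one : ν ≤ 1 := by
  have h := (hA.le_dotProduct hy (X := fun _ => 1) fun _ => rfl).trans
    (hA.dotProduct_le hy fun _ => rfl)
  have hpos : 0 < (fun _ : Fin 3 × Fin 3 => (1 : ℝ)) ⬝ᵥ (fun _ => (1 : ℝ)) := by
    simp [dotProduct]
  have h2 := le_of_mul_le_mul_right h hpos
  rw [le_div_iff₀ hA.pos] at h2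
  nlinarith [hA.pos]

include hA in
lemma IsCoefficient.mulVec_swap (X : Fin 3 × Fin 3 → ℝ) (p : Fin 3 × Fin 3) :
    (tensorMatrix (A y)).mulVec X p.swap = (tensorMatrix (A y)).mulVec X p := by
  simp only [Matrix.mulVec, tensorMatrix, dotProduct, Matrix.of_apply, Prod.fst_swap,
    Prod.snd_swap]
  exact Finset.sum_congr rfl fun q _ => by rw [hA.minor_symm]

include hA in
lemma IsCoefficient.mulVec_comp_swap (X : Fin 3 × Fin 3 → ℝ) :
    (tensorMatrix (A y)).mulVec (X ∘ Prod.swap) = (tensorMatrix (A y)).mulVec X := by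
  ext p
  simp only [Matrix.mulVec, dotProduct, Function.comp]
  rw [← (Equiv.prodComm (Fin 3) (Fin 3)).sum_comp]
  refine Finset.sum_congr rfl fun q _ => ?_
  simp only [tensorMatrix, Matrix.of_apply, Equiv.prodComm_apply, Prod.fst_swap, Prod.snd_swap,
    Prod.swap_swap]
  rw [hA.major_symm, hA.minor_symm, hA.major_symm]

include hA in
lemma IsCoefficient.dotProduct_mulVec_comm (X Y : Fin 3 × Fin 3 → ℝ) :
    (tensorMatrix (A y)).mulVec X ⬝ᵥ Y = (tensorMatrix (A y)).mulVec Y ⬝ᵥ X := by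
  rw [dotProduct_comm, Matrix.dotProduct_mulVec, ← Matrix.mulVec_transpose, hA.isSymm y]

include hA hy in
-- With Z = AX, positivity of the quadratic form at X − νZ gives 0 ≤ Z·X − 2ν|Z|² + ν²(AZ·Z). The
-- upper bound on AZ·Z absorbs one ν|Z|², so ν|Z|² ≤ Z·X ≤ ν⁻¹|X|². Minor symmetry makes Z
-- symmetric, as the ellipticity bounds require.
lemma IsCoefficient.mulVec_bound_of_symm {X : Fin 3 × Fin 3 → ℝ} (hX : ∀ p, X p.swap = X p) :
    ν ^ 2 * ((tensorMatrix (A y)).mulVec X ⬝ᵥ (tensorMatrix (A y)).mulVec X) ≤ X ⬝ᵥ X := by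
  set N := tensorMatrix (A y)
  set Z := N.mulVec X
  have hZ : ∀ p, Z p.swap = Z p := hA.mulVec_swap X
  have hν := hA.pos
  have h1 := hA.le_dotProduct hy (X := X - ν • Z) (fun p => by simp [hX p, hZ p])
  have h2 : 0 ≤ (X - ν • Z) ⬝ᵥ (X - ν • Z) := by
    rw [dotProduct_self_eq]; positivity
  have h3 : N.mulVec (X - ν • Z) ⬝ᵥ (X - ν • Z) =
      Z ⬝ᵥ X - 2 * ν * (Z ⬝ᵥ Z) + ν ^ 2 * (N.mulVec Z ⬝ᵥ Z) := by
    have : N.mulVec Z ⬝ᵥ X = Z ⬝ᵥ Z := hA.dotProduct_mulVec_comm Z X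
    simp only [Matrix.mulVec_sub, Matrix.mulVec_smul, sub_dotProduct, dotProduct_sub,
      smul_dotProduct, dotProduct_smul, smul_eq_mul, this]
    ring
  have h4 := hA.dotProduct_le hy hX
  have h5 := hA.dotProduct_le hy hZ
  have h6 : 0 ≤ Z ⬝ᵥ X - 2 * ν * (Z ⬝ᵥ Z) + ν ^ 2 * (N.mulVec Z ⬝ᵥ Z) := by
    rw [← h3]; exact (mul_nonneg hν.le h2).trans h1
  have h7 : ν ^ 2 * (N.mulVec Z ⬝ᵥ Z) ≤ ν * (Z ⬝ᵥ Z) := by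
    refine (mul_le_mul_of_nonneg_left h5 (sq_nonneg ν)).trans_eq ?_
    field_simp
  have h8 : ν * (Z ⬝ᵥ Z) ≤ 1 / ν * (X ⬝ᵥ X) := by
    have : Z ⬝ᵥ X ≤ 1 / ν * (X ⬝ᵥ X) := h4
    linarith
  calc ν ^ 2 * (Z ⬝ᵥ Z) = ν * (ν * (Z ⬝ᵥ Z)) := by ring
    _ ≤ ν * (1 / ν * (X ⬝ᵥ X)) := by gcongr
    _ = X ⬝ᵥ X := by field_simp

include hA hy in
-- The tensor sees only the symmetric part of X, and symmetrisation does not increase the norm.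
lemma IsCoefficient.mulVec_bound (X : Fin 3 × Fin 3 → ℝ) :
    ν ^ 2 * ((tensorMatrix (A y)).mulVec X ⬝ᵥ (tensorMatrix (A y)).mulVec X) ≤ X ⬝ᵥ X := by
  set S : Fin 3 × Fin 3 → ℝ := (1 / 2 : ℝ) • (X + X ∘ Prod.swap) with hS
  have h1 : (tensorMatrix (A y)).mulVec S = (tensorMatrix (A y)).mulVec X := by
    rw [hS, Matrix.mulVec_smul, Matrix.mulVec_add, hA.mulVec_comp_swap, ← two_smul ℝ, smul_smul]
    norm_num
  rw [← h1]
  refine (hA.mulVec_bound_of_symm hy fun p => ?_).trans ?_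
  · simp [hS, add_comm]
  · simp only [dotProduct, Fintype.sum_prod_type, Fin.sum_univ_three, hS, Pi.smul_apply,
      Pi.add_apply, Function.comp, Prod.swap, smul_eq_mul]
    nlinarith [sq_nonneg (X (0, 1) - X (1, 0)), sq_nonneg (X (0, 2) - X (2, 0)),
      sq_nonneg (X (1, 2) - X (2, 1))]

/-- The action of a real fourth-order tensor on complex matrices. -/
noncomputable def tensorCLM (a : Fin 3 → Fin 3 → Fin 3 → Fin 3 → ℝ) : MatF →L[ℂ] MatF :=
  Matrix.toEuclideanCLM (n := Fin 3 × Fin 3) (𝕜 := ℂ) ((tensorMatrix a).map Complex.ofReal)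

lemma tensorCLM_apply (a : Fin 3 → Fin 3 → Fin 3 → Fin 3 → ℝ) (M : MatF) (i j : Fin 3) :
    tensorCLM a M (i, j) = ∑ k, ∑ l, (a i j k l : ℂ) * M (k, l) := by
  simp [tensorCLM, Matrix.mulVec, dotProduct, Fintype.sum_prod_type, tensorMatrix,
    Matrix.ofLp_toEuclideanCLM]

lemma re_tensorCLM (a : Fin 3 → Fin 3 → Fin 3 → Fin 3 → ℝ) (M : MatF) (p : Fin 3 × Fin 3) :
    (tensorCLM a M p).re = (tensorMatrix a).mulVec (fun q => (M q).re) p := by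
  simp [tensorCLM, Matrix.mulVec, dotProduct, Matrix.ofLp_toEuclideanCLM]

lemma im_tensorCLM (a : Fin 3 → Fin 3 → Fin 3 → Fin 3 → ℝ) (M : MatF) (p : Fin 3 × Fin 3) :
    (tensorCLM a M p).im = (tensorMatrix a).mulVec (fun q => (M q).im) p := by
  simp [tensorCLM, Matrix.mulVec, dotProduct, Matrix.ofLp_toEuclideanCLM]

lemma norm_sq_eq_re_add_im (M : MatF) :
    ‖M‖ ^ 2 = (fun q => (M q).re) ⬝ᵥ (fun q => (M q).re) +
      (fun q => (M q).im) ⬝ᵥ (fun q => (M q).im) := by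
  simp [EuclideanSpace.norm_sq_eq, dotProduct, ← Finset.sum_add_distrib,
    ← Complex.normSq_eq_norm_sq, Complex.normSq_apply]

include hA hy in
lemma IsCoefficient.norm_tensorCLM_le (M : MatF) :
    ‖tensorCLM (A y) M‖ ≤ 1 / ν * ‖M‖ := by
  have hν := hA.pos
  have h1 := hA.mulVec_bound hy fun q => (M q).re
  have h2 := hA.mulVec_bound hy fun q => (M q).im
  have h3 : ν ^ 2 * ‖tensorCLM (A y) M‖ ^ 2 ≤ ‖M‖ ^ 2 := by
    rw [norm_sq_eq_re_add_im, norm_sq_eq_re_add_im]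
    simp only [re_tensorCLM, im_tensorCLM]
    linarith
  rw [← mul_pow] at h3
  have h4 := le_of_sq_le_sq h3 (norm_nonneg _)
  rw [one_div, inv_mul_eq_div, le_div_iff₀ hν]
  linarith

include hA in
lemma IsCoefficient.inner_tensorCLM_comm (M N : MatF) :
    inner ℂ (tensorCLM (A y) M) N = inner ℂ M (tensorCLM (A y) N) := by
  have h : IsSelfAdjoint (tensorCLM (A y)) := by
    refine IsSelfAdjoint.map (R := Matrix (Fin 3 × Fin 3) (Fin 3 × Fin 3) ℂ) ?_ _
    ext p q
    simp [(hA.isSymm y).apply]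
  exact h.isSymmetric M N

include hA hy in
lemma IsCoefficient.le_re_inner_tensorCLM {M : MatF} (hM : ∀ i j, M (i, j) = M (j, i)) :
    ν * ‖M‖ ^ 2 ≤ (inner ℂ M (tensorCLM (A y) M)).re := by
  have h1 := hA.le_dotProduct hy (X := fun q => (M q).re) fun p =>
    congrArg Complex.re (hM p.2 p.1)
  have h2 := hA.le_dotProduct hy (X := fun q => (M q).im) fun p =>
    congrArg Complex.im (hM p.2 p.1)
  have h3 : (inner ℂ M (tensorCLM (A y) M)).re =
      (tensorMatrix (A y)).mulVec (fun q => (M q).re) ⬝ᵥ (fun q => (M q).re) +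
      (tensorMatrix (A y)).mulVec (fun q => (M q).im) ⬝ᵥ (fun q => (M q).im) := by
    simp only [PiLp.inner_apply, dotProduct, ← re_tensorCLM, ← im_tensorCLM, Complex.re_sum,
      RCLike.inner_apply, Complex.mul_re, Complex.conj_re, Complex.conj_im,
      ← Finset.sum_add_distrib]
    exact Finset.sum_congr rfl fun p _ => by ring
  rw [h3, norm_sq_eq_re_add_im]
  linarith

end Pointwise

/-- The symmetric part of a matrix. -/
noncomputable def symCLM : MatF →L[ℂ] MatF :=
  LinearMap.toContinuousLinearMap
    { toFun := fun M => WithLp.toLp 2 fun p => (M p + M p.swap) / 2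
      map_add' := fun M N => by ext p; simp; ring
      map_smul' := fun c M => by ext p; simp; ring }

lemma symCLM_apply (M : MatF) (i j : Fin 3) : symCLM M (i, j) = (M (i, j) + M (j, i)) / 2 := rfl

lemma norm_symCLM_le (M : MatF) : ‖symCLM M‖ ≤ ‖M‖ := by
  refine le_of_sq_le_sq ?_ (norm_nonneg _)
  simp only [norm_sq_eq_re_add_im, dotProduct, Fintype.sum_prod_type, Fin.sum_univ_three,
    symCLM_apply, Complex.add_re, Complex.add_im, Complex.div_ofNat_re, Complex.div_ofNat_im]
  nlinarith [sq_nonneg ((M (0, 1)).re - (M (1, 0)).re), sq_nonneg ((M (0, 2)).re - (M (2, 0)).re),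
      sq_nonneg ((M (1, 2)).re - (M (2, 1)).re), sq_nonneg ((M (0, 1)).im - (M (1, 0)).im),
      sq_nonneg ((M (0, 2)).im - (M (2, 0)).im), sq_nonneg ((M (1, 2)).im - (M (2, 1)).im)]

/-- The map `c ↦ i sym (c χᵀ)`. -/
noncomputable def iXCLM (χ : EuclideanSpace ℝ (Fin 3)) : Vec →L[ℂ] MatF :=
  LinearMap.toContinuousLinearMap
    { toFun := fun c => WithLp.toLp 2 fun p => iX χ c p.1 p.2
      map_add' := fun c d => by ext p; simp [iX]; ring
      map_smul' := fun r c => by ext p; simp [iX]; ring }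

lemma iXCLM_apply (χ : EuclideanSpace ℝ (Fin 3)) (c : Vec) (i j : Fin 3) :
    iXCLM χ c (i, j) = iX χ c i j := rfl

/-- The value is the symmetric part of the rank-one matrix i c χᵀ, whose Frobenius norm is exactly
|χ||c|. -/
lemma norm_iXCLM_le (χ : EuclideanSpace ℝ (Fin 3)) (c : Vec) : ‖iXCLM χ c‖ ≤ ‖χ‖ * ‖c‖ := by
  set M : MatF := WithLp.toLp 2 fun p => Complex.I * (c p.1 * (χ p.2 : ℂ)) with hM
  have h1 : iXCLM χ c = symCLM M := by
    ext p
    obtain ⟨i, j⟩ := p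
    rw [iXCLM_apply, symCLM_apply]
    simp only [hM, iX, Matrix.of_apply]
    ring
  have h2 : ‖M‖ ^ 2 = (‖χ‖ * ‖c‖) ^ 2 := by
    rw [mul_pow]
    simp only [EuclideanSpace.norm_sq_eq, Fintype.sum_prod_type, hM, norm_mul, Complex.norm_I,
      one_mul, mul_pow, Complex.norm_real]
    rw [Finset.sum_mul_sum, Finset.sum_comm]
    exact Finset.sum_congr rfl fun i _ => Finset.sum_congr rfl fun j _ => mul_comm _ _
  rw [h1]
  refine (norm_symCLM_le M).trans (le_of_sq_le_sq h2.le (by positivity))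

/-! ### Operators on the Hilbert spaces -/

lemma norm_sq_eq_integral {E : Type*} [NormedAddCommGroup E] [InnerProductSpace ℂ E]
    (f : Lp E 2 (volume.restrict cell)) : ‖f‖ ^ 2 = ∫ y in cell, ‖f y‖ ^ 2 := by
  have h : (inner ℂ f f : ℂ) = ((∫ y in cell, ‖f y‖ ^ 2 : ℝ) : ℂ) := by
    rw [L2.inner_def, ← integral_complex_ofReal]
    congr 1
    ext y
    rw [inner_self_eq_norm_sq_to_K]
    simp
  have h2 := inner_self_eq_norm_sq (𝕜 := ℂ) f
  rw [h] at h2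
  exact h2.symm

lemma IsCoefficient.aestronglyMeasurable {A : TensorField} {ν : ℝ} (hA : IsCoefficient A ν)
    (E : L2Mat) :
    AEStronglyMeasurable (fun y => tensorCLM (A y) (E y)) (volume.restrict cell) := by
  have h : ∀ p : Fin 3 × Fin 3, AEStronglyMeasurable
      (fun y => tensorCLM (A y) (E y) p) (volume.restrict cell) := by
    rintro ⟨i, j⟩
    simp only [tensorCLM_apply]
    refine Finset.aestronglyMeasurable_fun_sum _ fun k _ =>
      Finset.aestronglyMeasurable_fun_sum _ fun l _ => AEStronglyMeasurable.mul ?_ ?_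
    · exact Complex.continuous_ofReal.comp_aestronglyMeasurable
        (hA.bounded i j k l).aestronglyMeasurable
    · exact (EuclideanSpace.proj (𝕜 := ℂ) (k, l)).continuous.comp_aestronglyMeasurable
        (Lp.aestronglyMeasurable E)
  exact (PiLp.continuous_toLp 2 (fun _ : Fin 3 × Fin 3 => ℂ)).comp_aestronglyMeasurable
    ((aemeasurable_pi_lambda _ fun p => (h p).aemeasurable).aestronglyMeasurable)

lemma ae_mem_cell : ∀ᵐ y ∂(volume.restrict cell), y ∈ cell :=
  ae_restrict_mem measurableSet_cell

lemma IsCoefficient.memLp {A : TensorField} {ν : ℝ} (hA : IsCoefficient A ν) (E : L2Mat) :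
    MemLp (fun y => tensorCLM (A y) (E y)) 2 (volume.restrict cell) :=
  (Lp.memLp E).of_le_mul (hA.aestronglyMeasurable E)
    (ae_mem_cell.mono fun y hy => hA.norm_tensorCLM_le hy (E y))

/-- Multiplication by the coefficient tensor on `L²(Y; ℂ^{3×3})`. -/
noncomputable def tensorL {A : TensorField} {ν : ℝ} (hA : IsCoefficient A ν) : L2Mat →L[ℂ] L2Mat :=
  LinearMap.mkContinuous
    { toFun := fun E => (hA.memLp E).toLp _
      map_add' := fun E F => by
        rw [← MemLp.toLp_add]
        refine MemLp.toLp_congr _ _ ?_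
        filter_upwards [Lp.coeFn_add E F] with y hy
        rw [hy]
        simp
      map_smul' := fun c E => by
        rw [RingHom.id_apply, ← MemLp.toLp_const_smul]
        refine MemLp.toLp_congr _ _ ?_
        filter_upwards [Lp.coeFn_smul c E] with y hy
        rw [hy]
        simp }
    (1 / ν) fun E => by
      refine Lp.norm_le_mul_norm_of_ae_le_mul ?_
      filter_upwards [(hA.memLp E).coeFn_toLp, ae_mem_cell] with y hy hc
      exact hy ▸ hA.norm_tensorCLM_le hc (E y)

section

variable {A : TensorField} {ν : ℝ} (hA : IsCoefficient A ν)

lemma coeFn_tensorL (E : L2Mat) :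
    tensorL hA E =ᵐ[volume.restrict cell] fun y => tensorCLM (A y) (E y) :=
  (hA.memLp E).coeFn_toLp

lemma norm_tensorL_le (E : L2Mat) : ‖tensorL hA E‖ ≤ 1 / ν * ‖E‖ := by
  refine Lp.norm_le_mul_norm_of_ae_le_mul ?_
  filter_upwards [coeFn_tensorL hA E, ae_mem_cell] with y hy hc
  exact hy ▸ hA.norm_tensorCLM_le hc (E y)

lemma inner_tensorL_comm (E F : L2Mat) :
    inner ℂ (tensorL hA E) F = inner ℂ E (tensorL hA F) := by
  rw [L2.inner_def, L2.inner_def]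
  refine integral_congr_ae ?_
  filter_upwards [coeFn_tensorL hA E, coeFn_tensorL hA F] with y h1 h2
  rw [h1, h2, hA.inner_tensorCLM_comm]

lemma le_re_inner_tensorL {E : L2Mat}
    (hE : ∀ᵐ y ∂(volume.restrict cell), ∀ i j, E y (i, j) = E y (j, i)) :
    ν * ‖E‖ ^ 2 ≤ (inner ℂ E (tensorL hA E)).re := by
  have hint : Integrable (fun y => inner ℂ (E y) (tensorL hA E y)) (volume.restrict cell) :=
    L2.integrable_inner E (tensorL hA E)
  rw [L2.inner_def, norm_sq_eq_integral, ← integral_const_mul]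
  refine le_trans ?_ (integral_re hint).le
  refine integral_mono_ae (((Lp.memLp E).integrable_norm_pow two_ne_zero).const_mul ν) hint.re ?_
  filter_upwards [coeFn_tensorL hA E, ae_mem_cell, hE] with y h1 hy h2
  rw [h1]
  exact hA.le_re_inner_tensorCLM hy h2

/-- The passage from the concrete integrals to Hilbert space. The test field sits on the left
because `inner` is conjugate-linear in its first argument. -/
lemma tensorForm_eq_inner {E F : (Fin 3 → ℝ) → Matrix (Fin 3) (Fin 3) ℂ} {E' F' : L2Mat}
    (hE : ∀ᵐ y ∂(volume.restrict cell), ∀ i j, E y i j = E' y (i, j))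
    (hF : ∀ᵐ y ∂(volume.restrict cell), ∀ i j, F y i j = F' y (i, j)) :
    tensorForm A E F = inner ℂ F' (tensorL hA E') := by
  rw [L2.inner_def, tensorForm]
  refine integral_congr_ae ?_
  filter_upwards [coeFn_tensorL hA E', hE, hF] with y h1 h2 h3
  rw [h1]
  simp only [PiLp.inner_apply, RCLike.inner_apply, Fintype.sum_prod_type, tensorCLM_apply, h2, h3]

end

lemma l2pair_eq_inner {g h : (Fin 3 → ℝ) → Vec} {g' h' : L2Vec}
    (hg : ∀ᵐ y ∂(volume.restrict cell), g y = g' y)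
    (hh : ∀ᵐ y ∂(volume.restrict cell), h y = h' y) :
    l2pair g h = inner ℂ h' g' := by
  rw [L2.inner_def, l2pair]
  refine integral_congr_ae ?_
  filter_upwards [hg, hh] with y h1 h2
  simp only [PiLp.inner_apply, RCLike.inner_apply, h1, h2]

/-! ### The periodic Sobolev space and its bounded operators. -/

noncomputable instance : CompleteSpace H1per :=
  (Submodule.isClosed_topologicalClosure smoothPeriodic).completeSpace_coe

/-- The inclusion `H¹_# → L²`. -/
noncomputable def valL : H1per →L[ℂ] L2Vec := WithLp.fstL 2 ℂ L2Vec L2Mat ∘L H1per.subtypeL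

/-- The gradient `H¹_# → L²`. -/
noncomputable def gradL : H1per →L[ℂ] L2Mat := WithLp.sndL 2 ℂ L2Vec L2Mat ∘L H1per.subtypeL

/-- The symmetrisation on `L²(Y; ℂ^{3×3})`. -/
noncomputable def symL : L2Mat →L[ℂ] L2Mat := symCLM.compLpL 2 (volume.restrict cell)

/-- The symmetrised gradient. -/
noncomputable def symGradL : H1per →L[ℂ] L2Mat := symL ∘L gradL

/-- The operator `u ↦ i X_χ u` on `L²(Y; ℂ³)`. -/
noncomputable def iXL (χ : EuclideanSpace ℝ (Fin 3)) : L2Vec →L[ℂ] L2Mat :=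
  (iXCLM χ).compLpL 2 (volume.restrict cell)

/-- The embedding of constants in `L²(Y; ℂ³)`. -/
noncomputable def constL : Vec →L[ℂ] L2Vec := Lp.constL 2 (volume.restrict cell) ℂ

lemma coeFn_constL (c : Vec) : constL c =ᵐ[volume.restrict cell] fun _ => c :=
  Lp.coeFn_const 2 _ c

lemma norm_constL (c : Vec) : ‖constL c‖ = ‖c‖ := by
  have h : ‖constL c‖ ^ 2 = ‖c‖ ^ 2 := by
    rw [norm_sq_eq_integral, integral_congr_ae (g := fun _ => ‖c‖ ^ 2)]
    · simp
    · filter_upwards [coeFn_constL c] with y hy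
      rw [hy]
  exact (sq_eq_sq₀ (norm_nonneg _) (norm_nonneg _)).1 h

lemma coeFn_symGradL (u : H1per) :
    ∀ᵐ y ∂(volume.restrict cell), ∀ i j, symGrad u y i j = symGradL u y (i, j) := by
  filter_upwards [symCLM.coeFn_compLpL (gradL u)] with y hy i j
  exact (congrFun (congrArg WithLp.ofLp hy) (i, j)).symm

lemma symGradL_symm (u : H1per) :
    ∀ᵐ y ∂(volume.restrict cell), ∀ i j, symGradL u y (i, j) = symGradL u y (j, i) := by
  filter_upwards [coeFn_symGradL u] with y hy i j
  rw [← hy, ← hy]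
  simp [symGrad, add_comm]

lemma coeFn_iXL (χ : EuclideanSpace ℝ (Fin 3)) (g : L2Vec) :
    ∀ᵐ y ∂(volume.restrict cell), ∀ i j, iX χ (g y) i j = iXL χ g y (i, j) := by
  filter_upwards [(iXCLM χ).coeFn_compLpL g] with y hy i j
  exact (congrFun (congrArg WithLp.ofLp hy) (i, j)).symm

lemma coeFn_iXL_constL (χ : EuclideanSpace ℝ (Fin 3)) (c : Vec) :
    ∀ᵐ y ∂(volume.restrict cell), ∀ i j, iX χ c i j = iXL χ (constL c) y (i, j) := by
  filter_upwards [coeFn_iXL χ (constL c), coeFn_constL c] with y hy hc i j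
  rw [← hy, hc]

lemma norm_iXL_le (χ : EuclideanSpace ℝ (Fin 3)) (g : L2Vec) : ‖iXL χ g‖ ≤ ‖χ‖ * ‖g‖ := by
  refine Lp.norm_le_mul_norm_of_ae_le_mul ?_
  filter_upwards [(iXCLM χ).coeFn_compLpL g] with y hy
  exact hy ▸ norm_iXCLM_le χ (g y)

lemma norm_symL_le (E : L2Mat) : ‖symL E‖ ≤ ‖E‖ := by
  refine Lp.norm_le_norm_of_ae_le ?_
  filter_upwards [symCLM.coeFn_compLpL E] with y hy
  exact hy ▸ norm_symCLM_le (E y)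

lemma symGradNorm_eq (u : H1per) : symGradNorm u = ‖symGradL u‖ := by
  rw [symGradNorm, Real.sqrt_eq_iff_eq_sq (by positivity) (norm_nonneg _), norm_sq_eq_integral]
  refine integral_congr_ae ?_
  filter_upwards [coeFn_symGradL u] with y hy
  simp only [EuclideanSpace.norm_sq_eq, Fintype.sum_prod_type, hy]

lemma norm_sq_eq (u : H1per) : ‖u‖ ^ 2 = ‖valL u‖ ^ 2 + ‖gradL u‖ ^ 2 :=
  WithLp.prod_norm_sq_eq_of_L2 _

lemma norm_valL_le (u : H1per) : ‖valL u‖ ≤ ‖u‖ :=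
  le_of_sq_le_sq (by rw [norm_sq_eq u]; linarith [sq_nonneg ‖gradL u‖]) (norm_nonneg _)

lemma norm_symGradL_le (u : H1per) : ‖symGradL u‖ ≤ ‖u‖ :=
  (norm_symL_le (gradL u)).trans
    (le_of_sq_le_sq (by rw [norm_sq_eq u]; linarith [sq_nonneg ‖valL u‖]) (norm_nonneg _))

lemma integral_eq_adjoint_constL (g : L2Vec) :
    ∫ y in cell, g y = ContinuousLinearMap.adjoint constL g := by
  refine ext_inner_left ℂ fun c => ?_
  rw [ContinuousLinearMap.adjoint_inner_right, L2.inner_def,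
    ← integral_inner ((Lp.memLp g).integrable (by norm_num))]
  refine integral_congr_ae ?_
  filter_upwards [coeFn_constL c] with y hy
  rw [hy]

/-- The embedding of constants in `H¹_#`. -/
noncomputable def constH : Vec →L[ℂ] H1per :=
  ((WithLp.prodContinuousLinearEquiv 2 ℂ L2Vec L2Mat).symm.toContinuousLinearMap ∘L
    ContinuousLinearMap.inl ℂ L2Vec L2Mat ∘L constL).codRestrict H1per fun c => by
      refine Submodule.le_topologicalClosure _ ⟨fun _ => c, contDiff_const, fun _ _ => rfl, ?_, ?_⟩
      · exact coeFn_constL c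
      · filter_upwards [Lp.coeFn_zero MatF 2 (volume.restrict cell)] with y hy i j
        rw [fderiv_fun_const]
        exact congrFun (congrArg WithLp.ofLp hy) (i, j)

lemma valL_constH (c : Vec) : valL (constH c) = constL c := rfl

lemma gradL_constH (c : Vec) : gradL (constH c) = 0 := rfl

lemma symGradL_constH (c : Vec) : symGradL (constH c) = 0 := by
  change symL (gradL (constH c)) = 0
  rw [gradL_constH, map_zero]

lemma norm_constH (c : Vec) : ‖constH c‖ = ‖c‖ := by
  have h := norm_sq_eq (constH c)
  rw [valL_constH, gradL_constH, norm_constL, norm_zero, zero_pow two_ne_zero, add_zero] at h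
  exact (sq_eq_sq₀ (norm_nonneg _) (norm_nonneg _)).1 h

lemma mean_eq (u : H1per) : mean u = ContinuousLinearMap.adjoint constL (valL u) :=
  integral_eq_adjoint_constL _

/-- Constants have zero gradient, so pairing with them in H¹ is pairing in L². Hence mean zero is
the same as orthogonality to constants in both spaces. -/
lemma mean_eq_adjoint_constH (u : H1per) : mean u = ContinuousLinearMap.adjoint constH u := by
  refine ext_inner_left ℂ fun c => ?_
  rw [mean_eq, ContinuousLinearMap.adjoint_inner_right, ContinuousLinearMap.adjoint_inner_right]
  change _ = inner ℂ (valL (constH c)) (valL u) + inner ℂ (gradL (constH c)) (gradL u)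
  rw [gradL_constH, inner_zero_left, add_zero, valL_constH]

lemma mean_constH (c : Vec) : mean (constH c) = c := by
  change ∫ y in cell, constL c y = c
  rw [integral_congr_ae (coeFn_constL c)]
  simp

/-! ### Korn's inequality -/

/-- Poincaré bounds the left side by 2|mean|² + 7‖∇φ‖², and Korn replaces ‖∇φ‖² by 2‖sym ∇φ‖². It is
phrased through continuous maps of the pair so that it defines a closed set. -/
lemma norm_sq_le_of_mem_smoothPeriodic {p : WithLp 2 (L2Vec × L2Mat)} (hp : p ∈ smoothPeriodic) :
    ‖p.fst‖ ^ 2 + ‖p.snd‖ ^ 2 ≤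
      2 * ‖ContinuousLinearMap.adjoint constL p.fst‖ ^ 2 + 14 * ‖symL p.snd‖ ^ 2 := by
  obtain ⟨φ, hφ, hper, h1, h2⟩ := hp
  have e1 : ‖p.fst‖ ^ 2 = ∫ y in cell, ‖φ y‖ ^ 2 := by
    rw [norm_sq_eq_integral]
    exact integral_congr_ae (h1.mono fun y hy => by simp only [hy])
  have e2 : ‖p.snd‖ ^ 2 = ∫ y in cell, ∑ i, ∑ j, ‖fderiv ℝ φ y (Pi.single j 1) i‖ ^ 2 := by
    rw [norm_sq_eq_integral]
    exact integral_congr_ae (h2.mono fun y hy => by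
      simp only [EuclideanSpace.norm_sq_eq, Fintype.sum_prod_type, hy])
  have e3 : ContinuousLinearMap.adjoint constL p.fst = ∫ y in cell, φ y := by
    rw [← integral_eq_adjoint_constL]
    exact integral_congr_ae h1
  have e4 : ‖symL p.snd‖ ^ 2 = ∫ y in cell, ∑ i, ∑ j, ‖(fderiv ℝ φ y (Pi.single j 1) i
        + fderiv ℝ φ y (Pi.single i 1) j) / 2‖ ^ 2 := by
    rw [norm_sq_eq_integral]
    refine integral_congr_ae ?_
    filter_upwards [h2, symCLM.coeFn_compLpL p.snd] with y hy hs
    have hs' : symL p.snd y = symCLM (p.snd y) := hs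
    simp only [EuclideanSpace.norm_sq_eq, Fintype.sum_prod_type, hs', symCLM_apply, hy]
  rw [e1, e2, e3, e4]
  linarith [poincare_smooth hφ hper, korn_smooth hφ hper]

lemma norm_sq_le_mean_add_symGradL (u : H1per) :
    ‖u‖ ^ 2 ≤ 2 * ‖mean u‖ ^ 2 + 14 * ‖symGradL u‖ ^ 2 := by
  have hcl : IsClosed {p : WithLp 2 (L2Vec × L2Mat) | ‖p.fst‖ ^ 2 + ‖p.snd‖ ^ 2 ≤
      2 * ‖ContinuousLinearMap.adjoint constL p.fst‖ ^ 2 + 14 * ‖symL p.snd‖ ^ 2} := by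
    have h1 : Continuous fun p : WithLp 2 (L2Vec × L2Mat) => p.fst :=
      (WithLp.fstL 2 ℂ L2Vec L2Mat).continuous
    have h2 : Continuous fun p : WithLp 2 (L2Vec × L2Mat) => p.snd :=
      (WithLp.sndL 2 ℂ L2Vec L2Mat).continuous
    exact isClosed_le (by fun_prop) (by fun_prop)
  rw [norm_sq_eq, mean_eq]
  exact closure_minimal (fun p hp => norm_sq_le_of_mem_smoothPeriodic hp) hcl u.2

lemma exists_isKornConstant : ∃ K : ℝ, IsKornConstant K := by
  -- The constant 4 suffices because 14 ≤ 4².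
  refine ⟨4, by norm_num, fun u hu => ?_⟩
  rw [symGradNorm_eq]
  refine le_of_sq_le_sq ?_ (by positivity)
  have := norm_sq_le_mean_add_symGradL u
  rw [hu, norm_zero] at this
  nlinarith [sq_nonneg ‖symGradL u‖]

/-! ### Solvability of the variational problems -/

lemma cell_nonempty : cell.Nonempty := ⟨0, fun _ _ => by simp⟩

lemma IsCoefficient.le_one {A : TensorField} {ν : ℝ} (hA : IsCoefficient A ν) : ν ≤ 1 :=
  hA.ellipticity_le_one cell_nonempty.some_mem

lemma mean_add (u v : H1per) : mean (u + v) = mean u + mean v := by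
  simp only [mean_eq_adjoint_constH, map_add]

lemma mean_sub (u v : H1per) : mean (u - v) = mean u - mean v := by
  simp only [mean_eq_adjoint_constH, map_sub]

lemma mean_zero : mean 0 = 0 := by
  simp only [mean_eq_adjoint_constH, map_zero]

lemma eq_zero_of_symGradL_eq_zero {u : H1per} (hu : symGradL u = 0) (hm : mean u = 0) : u = 0 := by
  have h := norm_sq_le_mean_add_symGradL u
  rw [hu, hm, norm_zero, norm_zero] at h
  exact norm_eq_zero.1 (pow_eq_zero_iff two_ne_zero |>.1 (le_antisymm (by linarith) (sq_nonneg _)))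

/-- Periodicity rules out infinitesimal rotations, so the kernel of the symmetric gradient consists
of the constants alone. -/
lemma eq_constH_of_symGradL_eq_zero {u : H1per} (hu : symGradL u = 0) : u = constH (mean u) := by
  refine sub_eq_zero.1 (eq_zero_of_symGradL_eq_zero ?_ ?_)
  · rw [map_sub, hu, symGradL_constH, sub_zero]
  · rw [mean_sub, mean_constH, sub_self]

section

variable {A : TensorField} {ν : ℝ} (hA : IsCoefficient A ν)

lemma le_re_inner_symGradL (u : H1per) :
    ν * ‖symGradL u‖ ^ 2 ≤ (inner ℂ (symGradL u) (tensorL hA (symGradL u))).re :=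
  le_re_inner_tensorL hA (symGradL_symm u)

include hA in
lemma symGradL_eq_zero_of_inner_eq_zero {u : H1per}
    (hu : inner ℂ (symGradL u) (tensorL hA (symGradL u)) = 0) : symGradL u = 0 := by
  have h := le_re_inner_symGradL hA u
  rw [hu, Complex.zero_re] at h
  have := hA.pos
  have h2 : ‖symGradL u‖ ^ 2 ≤ 0 := by
    by_contra! h3
    nlinarith [mul_pos this h3]
  exact norm_eq_zero.1 (pow_eq_zero_iff two_ne_zero |>.1 (le_antisymm h2 (sq_nonneg _)))

include hA in
lemma eq_of_inner_eq {u w : H1per}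
    (h : ∀ v, inner ℂ (symGradL v) (tensorL hA (symGradL u)) =
      inner ℂ (symGradL v) (tensorL hA (symGradL w))) (hm : mean u = mean w) : u = w := by
  refine sub_eq_zero.1 (eq_zero_of_symGradL_eq_zero
    (symGradL_eq_zero_of_inner_eq_zero hA ?_) (by rw [mean_sub, hm, sub_self]))
  conv_lhs => rw [map_sub symGradL, map_sub (tensorL hA), inner_sub_right, ← map_sub symGradL]
  rw [h, sub_self]

/-- Solvability of the elliptic problem for data orthogonal to the constants. -/
lemma exists_solution {b : H1per} (hb : mean b = 0) :
    ∃ u : H1per, (∀ v, inner ℂ (symGradL v) (tensorL hA (symGradL u)) = inner ℂ v b) ∧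
      mean u = 0 := by
  have hν := hA.pos
  -- Adding mean* mean to the elliptic operator makes it coercive on all of H¹_#. The lower bound
  -- ν/14 comes from the basic estimate together with ν ≤ 1, which lets the mean term absorb 2ν|mean
  -- u|².
  set P : H1per →L[ℂ] H1per :=
    ContinuousLinearMap.adjoint symGradL ∘L tensorL hA ∘L symGradL +
      constH ∘L ContinuousLinearMap.adjoint constH with hP
  have hPi : ∀ u v, inner ℂ v (P u) =
      inner ℂ (symGradL v) (tensorL hA (symGradL u)) + inner ℂ (mean v) (mean u) := by
    intro u v
    rw [mean_eq_adjoint_constH v, ContinuousLinearMap.adjoint_inner_left,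
      ← ContinuousLinearMap.adjoint_inner_right, mean_eq_adjoint_constH, ← inner_add_right]
    rfl
  have hunit : IsUnit P := by
    refine ContinuousLinearMap.isUnit_of_forall_le_norm_inner_map P
      (c := ⟨ν / 14, by positivity⟩) (by exact_mod_cast (by positivity : 0 < ν / 14)) fun u => ?_
    rw [norm_inner_symm, hPi]
    refine le_trans ?_ (Complex.re_le_norm _)
    rw [Complex.add_re, inner_self_eq_norm_sq_to_K]
    have h1 := le_re_inner_symGradL hA u
    have h2 := norm_sq_le_mean_add_symGradL u
    have h3 : (((‖mean u‖ : ℝ) : ℂ) ^ 2).re = ‖mean u‖ ^ 2 := by norm_cast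
    have h4 := mul_le_mul_of_nonneg_left h2 hν.le
    have h5 := mul_le_mul_of_nonneg_right hA.le_one (sq_nonneg ‖mean u‖)
    change ‖u‖ ^ 2 * (ν / 14) ≤ _ + (((‖mean u‖ : ℝ) : ℂ) ^ 2).re
    rw [h3]
    nlinarith [sq_nonneg ‖mean u‖]
  obtain ⟨u, hu⟩ := (ContinuousLinearMap.isUnit_iff_bijective.1 hunit).2 b
  have hmu : mean u = 0 := by
    -- Testing with the constant mean u leaves |mean u|² = 0, so the added term is inactive for the
    -- given load.
    have h := hPi u (constH (mean u))
    rw [hu, symGradL_constH, inner_zero_left, zero_add, mean_constH,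
      ← ContinuousLinearMap.adjoint_inner_right, ← mean_eq_adjoint_constH, hb,
      inner_zero_right] at h
    exact inner_self_eq_zero.1 h.symm
  refine ⟨u, fun v => ?_, hmu⟩
  have h := hPi u v
  rw [hmu, inner_zero_right, add_zero, hu] at h
  exact h.symm

/-! ### Cell correctors and the homogenized matrix -/

/-- The operator `c ↦ i X_χ c` with values in the constant matrix fields. -/
noncomputable def iXconst (χ : EuclideanSpace ℝ (Fin 3)) : Vec →L[ℂ] L2Mat := iXL χ ∘L constL

lemma norm_iXconst_le (χ : EuclideanSpace ℝ (Fin 3)) (c : Vec) :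
    ‖iXconst χ c‖ ≤ ‖χ‖ * ‖c‖ :=
  (norm_iXL_le χ (constL c)).trans_eq (by rw [norm_constL])

lemma ae_symGrad_add_iX (χ : EuclideanSpace ℝ (Fin 3)) (c : Vec) (u : H1per) :
    ∀ᵐ y ∂(volume.restrict cell), ∀ i j, (symGrad u y + iX χ c) i j =
      (symGradL u + iXconst χ c) y (i, j) := by
  filter_upwards [coeFn_symGradL u, coeFn_iXL_constL χ c,
    Lp.coeFn_add (symGradL u) (iXconst χ c)] with y h1 h2 h3 i j
  rw [h3, Matrix.add_apply, h1, h2]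
  rfl

lemma isCellCorrector_iff {χ : EuclideanSpace ℝ (Fin 3)} {c : Vec} {w : H1per} :
    IsCellCorrector A χ c w ↔
      (∀ v, inner ℂ (symGradL v) (tensorL hA (symGradL w + iXconst χ c)) = 0) ∧ mean w = 0 := by
  refine and_congr (forall_congr' fun v => ?_) Iff.rfl
  rw [tensorForm_eq_inner hA (ae_symGrad_add_iX χ c w) (coeFn_symGradL v)]

include hA in
lemma existsUnique_isCellCorrector (χ : EuclideanSpace ℝ (Fin 3)) (c : Vec) :
    ∃! w : H1per, IsCellCorrector A χ c w := by
  simp only [isCellCorrector_iff hA, map_add, inner_add_right]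
  -- The load only sees sym ∇v, hence vanishes on constants.
  have hb : mean (-ContinuousLinearMap.adjoint symGradL (tensorL hA (iXconst χ c))) = 0 := by
    refine ext_inner_left ℂ fun d => ?_
    rw [mean_eq_adjoint_constH, ContinuousLinearMap.adjoint_inner_right, inner_neg_right,
      ContinuousLinearMap.adjoint_inner_right, symGradL_constH, inner_zero_left, inner_zero_right,
      neg_zero]
  obtain ⟨w, hw, hm⟩ := exists_solution hA hb
  refine ⟨w, ⟨fun v => ?_, hm⟩, fun w' hw' => eq_of_inner_eq hA (fun v => ?_) ?_⟩
  · rw [hw, inner_neg_right, ContinuousLinearMap.adjoint_inner_right, neg_add_cancel]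
  · rw [hw, inner_neg_right, ContinuousLinearMap.adjoint_inner_right]
    exact eq_neg_of_add_eq_zero_left (hw'.1 v)
  · rw [hm, hw'.2]

include hA in
lemma isCellCorrector_cellCorrector (χ : EuclideanSpace ℝ (Fin 3)) (c : Vec) :
    IsCellCorrector A χ c (cellCorrector A χ c) :=
  Classical.epsilon_spec (existsUnique_isCellCorrector hA χ c).exists

/-- The field `sym ∇u_c + i X_χ c` of the cell corrector for `c`. -/
noncomputable def correctedField (A : TensorField) (χ : EuclideanSpace ℝ (Fin 3)) (c : Vec) :
    L2Mat :=
  symGradL (cellCorrector A χ c) + iXconst χ c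

lemma inner_symGradL_correctedField (χ : EuclideanSpace ℝ (Fin 3)) (c : Vec) (v : H1per) :
    inner ℂ (symGradL v) (tensorL hA (correctedField A χ c)) = 0 :=
  ((isCellCorrector_iff hA).1 (isCellCorrector_cellCorrector hA χ c)).1 v

/-- The corrector equation allows the gradient of the corrector for d to be added to the test field.
This makes A_χ^hom a Gram matrix and hence Hermitian. -/
lemma inner_correctedField (χ : EuclideanSpace ℝ (Fin 3)) (c d : Vec) :
    inner ℂ (correctedField A χ d) (tensorL hA (correctedField A χ c)) =
      inner ℂ (iXconst χ d) (tensorL hA (correctedField A χ c)) := by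
  conv_lhs => rw [correctedField, inner_add_left, inner_symGradL_correctedField, zero_add]

include hA in
-- Two solutions differ by a function of zero energy, so the field does not depend on the solution
-- chosen. This gives linearity in c despite the choice in `cellCorrector`, and identifies the field
-- built from u₁.
lemma correctedField_eq (χ : EuclideanSpace ℝ (Fin 3)) {c : Vec} {w : H1per}
    (hw : ∀ v, inner ℂ (symGradL v) (tensorL hA (symGradL w + iXconst χ c)) = 0) :
    correctedField A χ c = symGradL w + iXconst χ c := by
  have h : symGradL (cellCorrector A χ c - w) = 0 := by
    refine symGradL_eq_zero_of_inner_eq_zero hA ?_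
    have h1 := inner_symGradL_correctedField hA χ c (cellCorrector A χ c - w)
    have h2 := hw (cellCorrector A χ c - w)
    have h3 : symGradL (cellCorrector A χ c - w) =
        correctedField A χ c - (symGradL w + iXconst χ c) := by
      rw [correctedField, map_sub]; abel
    conv_lhs => rw [h3, map_sub (tensorL hA), inner_sub_right, ← h3]
    rw [h1, h2, sub_zero]
  rw [map_sub, sub_eq_zero] at h
  rw [correctedField, h]

include hA in
lemma correctedField_add (χ : EuclideanSpace ℝ (Fin 3)) (c d : Vec) :
    correctedField A χ (c + d) = correctedField A χ c + correctedField A χ d := by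
  have e : ∀ a b a' b' : L2Mat, a + b + (a' + b') = a + a' + (b + b') := fun a b a' b' => by abel
  have e2 : correctedField A χ c + correctedField A χ d =
      symGradL (cellCorrector A χ c + cellCorrector A χ d) + iXconst χ (c + d) := by
    rw [correctedField, correctedField, map_add, map_add, e]
  rw [e2]
  refine correctedField_eq hA χ fun v => ?_
  rw [← e2, map_add, inner_add_right, inner_symGradL_correctedField,
    inner_symGradL_correctedField, add_zero]

include hA in
lemma correctedField_smul (χ : EuclideanSpace ℝ (Fin 3)) (a : ℂ) (c : Vec) :
    correctedField A χ (a • c) = a • correctedField A χ c := by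
  have e2 : a • correctedField A χ c =
      symGradL (a • cellCorrector A χ c) + iXconst χ (a • c) := by
    rw [correctedField, map_smul, map_smul, smul_add]
  rw [e2]
  refine correctedField_eq hA χ fun v => ?_
  rw [← e2, map_smul, inner_smul_right, inner_symGradL_correctedField, mul_zero]

lemma homMatrix_apply (χ : EuclideanSpace ℝ (Fin 3)) (i j : Fin 3) :
    homMatrix A χ i j = inner ℂ (correctedField A χ (EuclideanSpace.single i 1))
      (tensorL hA (correctedField A χ (EuclideanSpace.single j 1))) := by
  rw [inner_correctedField]
  exact tensorForm_eq_inner hA (ae_symGrad_add_iX χ _ _) (coeFn_iXL_constL χ _)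

include hA in
lemma isHermitian_homMatrix (χ : EuclideanSpace ℝ (Fin 3)) : (homMatrix A χ).IsHermitian := by
  ext i j
  rw [Matrix.conjTranspose_apply, homMatrix_apply hA, homMatrix_apply hA]
  exact (inner_conj_symm _ _).trans (inner_tensorL_comm hA _ _)

include hA in
lemma isHermitian_scaledHom (χ : EuclideanSpace ℝ (Fin 3)) : (scaledHom A χ).IsHermitian := by
  have h := isHermitian_homMatrix hA χ
  rw [Matrix.IsHermitian] at h ⊢
  rw [scaledHom, Matrix.conjTranspose_smul, h]
  simp

lemma inner_homMatrix (χ : EuclideanSpace ℝ (Fin 3)) (c d : Vec) :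
    inner ℂ d (Matrix.toEuclideanCLM (n := Fin 3) (𝕜 := ℂ) (homMatrix A χ) c) =
      inner ℂ (iXconst χ d) (tensorL hA (correctedField A χ c)) := by
  rw [← inner_correctedField]
  have hsum : ∀ c : Vec, correctedField A χ c =
      ∑ i, c i • correctedField A χ (EuclideanSpace.single i 1) := by
    intro c
    have h1 : c = ∑ i, c i • EuclideanSpace.single i (1 : ℂ) := by
      ext k
      simp [Pi.single_apply]
    let F : Vec →ₗ[ℂ] L2Mat :=
      { toFun := correctedField A χ
        map_add' := correctedField_add hA χ
        map_smul' := correctedField_smul hA χ }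
    change F c = ∑ i, c i • F (EuclideanSpace.single i 1)
    conv_lhs => rw [h1]
    simp only [map_sum, map_smul]
  rw [hsum c, hsum d, map_sum, sum_inner]
  simp only [PiLp.inner_apply, RCLike.inner_apply, Matrix.ofLp_toEuclideanCLM, Matrix.mulVec,
    dotProduct, homMatrix_apply hA, inner_sum, inner_smul_left, inner_smul_right, map_smul]
  refine Finset.sum_congr rfl fun i _ => ?_
  rw [Finset.sum_mul]
  exact Finset.sum_congr rfl fun j _ => by ring

end

/-! ### The resolvent of a Hermitian matrix -/

/-- In an orthonormal eigenbasis M − z multiplies each coordinate by λ_i − z, whose modulus is at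
least the distance to the spectrum. -/
lemma infDist_spectrum_mul_norm_le {n : Type*} [Fintype n] [DecidableEq n] {M : Matrix n n ℂ}
    (hM : M.IsHermitian) (z : ℂ) (x : EuclideanSpace ℂ n) :
    Metric.infDist z (spectrum ℂ M) * ‖x‖ ≤
      ‖Matrix.toEuclideanCLM (n := n) (𝕜 := ℂ) M x - z • x‖ := by
  set b := hM.eigenvectorBasis
  set y := Matrix.toEuclideanCLM (n := n) (𝕜 := ℂ) M x - z • x with hy
  have hb : ∀ i, inner ℂ (b i) y = ((hM.eigenvalues i : ℂ) - z) * inner ℂ (b i) x := by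
    intro i
    have hs : IsSelfAdjoint (Matrix.toEuclideanCLM (n := n) (𝕜 := ℂ) M) :=
      IsSelfAdjoint.map (R := Matrix n n ℂ) hM _
    have h1 : Matrix.toEuclideanCLM (n := n) (𝕜 := ℂ) M (b i) = (hM.eigenvalues i : ℂ) • b i := by
      ext k
      rw [Matrix.ofLp_toEuclideanCLM, hM.mulVec_eigenvectorBasis]
      simp [b]
    have h2 : inner ℂ (b i) (Matrix.toEuclideanCLM (n := n) (𝕜 := ℂ) M x) =
        inner ℂ (Matrix.toEuclideanCLM (n := n) (𝕜 := ℂ) M (b i)) x := (hs.isSymmetric _ _).symm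
    rw [hy, inner_sub_right, inner_smul_right, h2, h1, inner_smul_left, Complex.conj_ofReal, sub_mul]
  have hspec : ∀ i, (hM.eigenvalues i : ℂ) ∈ spectrum ℂ M := by
    intro i
    rw [hM.spectrum_eq_image_range]
    exact ⟨_, ⟨i, rfl⟩, rfl⟩
  refine le_of_sq_le_sq ?_ (norm_nonneg _)
  rw [mul_pow, ← b.sum_sq_norm_inner_right x, ← b.sum_sq_norm_inner_right y, Finset.mul_sum]
  refine Finset.sum_le_sum fun i _ => ?_
  rw [hb, norm_mul, mul_pow]
  gcongr
  · exact Metric.infDist_nonneg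
  · rw [norm_sub_rev, ← dist_eq_norm]
    exact Metric.infDist_le_dist_of_mem (hspec i)

lemma infDist_spectrum_pos {n : Type*} [Fintype n] [DecidableEq n] [Nonempty n] {M : Matrix n n ℂ}
    {z : ℂ} (hz : z ∈ resolventSet ℂ M) : 0 < Metric.infDist z (spectrum ℂ M) := by
  -- `Metric.infDist` to the empty set is 0, so positivity needs a nonempty spectrum.
  have hne : (spectrum ℂ M).Nonempty := spectrum.nonempty_of_isAlgClosed_of_finiteDimensional ℂ M
  exact ((Matrix.finite_spectrum M).isClosed.notMem_iff_infDist_pos hne).1 fun h => h hz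

/-! ### One cycle -/

/-- The operator `u ↦ i X_χ u` on `H¹_#`. -/
noncomputable def iXH (χ : EuclideanSpace ℝ (Fin 3)) : H1per →L[ℂ] L2Mat := iXL χ ∘L valL

/-- The operator `|χ|⁻² A_χ^hom` on `ℂ³`. -/
noncomputable def scaledHomL (A : TensorField) (χ : EuclideanSpace ℝ (Fin 3)) : Vec →L[ℂ] Vec :=
  Matrix.toEuclideanCLM (n := Fin 3) (𝕜 := ℂ) (scaledHom A χ)

lemma iXH_constH (χ : EuclideanSpace ℝ (Fin 3)) (c : Vec) : iXH χ (constH c) = iXconst χ c := rfl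

lemma norm_iXH_le (χ : EuclideanSpace ℝ (Fin 3)) (u : H1per) : ‖iXH χ u‖ ≤ ‖χ‖ * ‖u‖ :=
  (norm_iXL_le χ (valL u)).trans (mul_le_mul_of_nonneg_left (norm_valL_le u) (norm_nonneg _))

lemma coeFn_iXH (χ : EuclideanSpace ℝ (Fin 3)) (u : H1per) :
    ∀ᵐ y ∂(volume.restrict cell), ∀ i j, iXf χ u y i j = iXH χ u y (i, j) :=
  coeFn_iXL χ (valL u)

lemma inner_constL_valL (d : Vec) (u : H1per) :
    inner ℂ (constL d) (valL u) = inner ℂ d (mean u) := by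
  rw [mean_eq, ContinuousLinearMap.adjoint_inner_right]

section

variable {A : TensorField} {ν : ℝ} (hA : IsCoefficient A ν) {χ : EuclideanSpace ℝ (Fin 3)} {z : ℂ}
  {g : L2Vec} {p₁ p₂ q₂ u₀ u₁ u₂ : H1per}

lemma cycleEqs_iff :
    CycleEqs A χ z g p₁ p₂ q₂ u₀ u₁ u₂ ↔
      (∀ v, inner ℂ (symGradL v) (tensorL hA (symGradL u₀)) = 0) ∧
      (∀ v, inner ℂ (symGradL v) (tensorL hA (symGradL u₁)) =
        -inner ℂ (symGradL v) (tensorL hA (iXH χ u₀))) ∧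
      mean u₁ = 0 ∧
      (∀ v, inner ℂ (symGradL v) (tensorL hA (symGradL u₂)) =
        -inner ℂ (symGradL v) (tensorL hA (iXH χ (u₁ + p₂)))
        - inner ℂ (iXH χ v) (tensorL hA (symGradL (u₁ + p₂)))
        - inner ℂ (iXH χ v) (tensorL hA (iXH χ (u₀ + p₁ + q₂)))
        + z * (‖χ‖ : ℂ) ^ 2 * inner ℂ (valL v) (valL (u₀ + p₁ + q₂))
        + (‖χ‖ : ℂ) ^ 2 * inner ℂ (valL v) g) ∧
      mean u₂ = 0 ∧
      (∀ d, inner ℂ d (scaledHomL A χ (mean u₀)) - z * inner ℂ d (mean u₀) =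
        -(((1 / ‖χ‖ ^ 2 : ℝ) : ℂ) *
          inner ℂ (iXconst χ d) (tensorL hA (symGradL p₂ + iXH χ (p₁ + q₂))))
        + inner ℂ (constL d) g) := by
  have hG := coeFn_symGradL
  have hX := coeFn_iXH χ
  have hsum : ∀ᵐ y ∂(volume.restrict cell), ∀ i j,
      (symGrad p₂ y + iXf χ (p₁ + q₂) y) i j = (symGradL p₂ + iXH χ (p₁ + q₂)) y (i, j) := by
    filter_upwards [hG p₂, hX (p₁ + q₂), Lp.coeFn_add (symGradL p₂) (iXH χ (p₁ + q₂))]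
      with y h1 h2 h3 i j
    rw [h3, Matrix.add_apply, h1, h2]
    rfl
  have hv : ∀ u : H1per, ∀ᵐ y ∂(volume.restrict cell), val u y = valL u y := fun u =>
    Filter.Eventually.of_forall fun _ => rfl
  have hg : ∀ᵐ y ∂(volume.restrict cell), g y = g y := Filter.Eventually.of_forall fun _ => rfl
  have hd : ∀ d : Vec, ∀ᵐ y ∂(volume.restrict cell), d = constL d y := fun d =>
    (coeFn_constL d).mono fun _ h => h.symm
  have hS : ∀ d : Vec, ∑ i, (scaledHom A χ).mulVec (mean u₀) i * conj (d i) =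
      inner ℂ d (scaledHomL A χ (mean u₀)) := fun d => by
    simp [PiLp.inner_apply, scaledHomL, Matrix.ofLp_toEuclideanCLM]
  have e0 : ∀ v, tensorForm A (symGrad u₀) (symGrad v) = _ := fun v =>
    tensorForm_eq_inner hA (hG u₀) (hG v)
  have e1 : ∀ v, tensorForm A (symGrad u₁) (symGrad v) = _ := fun v =>
    tensorForm_eq_inner hA (hG u₁) (hG v)
  have e1' : ∀ v, tensorForm A (iXf χ u₀) (symGrad v) = _ := fun v =>
    tensorForm_eq_inner hA (hX u₀) (hG v)
  have e2 : ∀ v, tensorForm A (symGrad u₂) (symGrad v) = _ := fun v =>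
    tensorForm_eq_inner hA (hG u₂) (hG v)
  have e2a : ∀ v, tensorForm A (iXf χ (u₁ + p₂)) (symGrad v) = _ := fun v =>
    tensorForm_eq_inner hA (hX _) (hG v)
  have e2b : ∀ v, tensorForm A (symGrad (u₁ + p₂)) (iXf χ v) = _ := fun v =>
    tensorForm_eq_inner hA (hG _) (hX v)
  have e2c : ∀ v, tensorForm A (iXf χ (u₀ + p₁ + q₂)) (iXf χ v) = _ := fun v =>
    tensorForm_eq_inner hA (hX _) (hX v)
  have e2d : ∀ v, l2pair (val (u₀ + p₁ + q₂)) (val v) = _ := fun v =>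
    l2pair_eq_inner (hv _) (hv v)
  have e2e : ∀ v, l2pair g (val v) = _ := fun v => l2pair_eq_inner hg (hv v)
  have e3a : ∀ d, l2pair (val u₀) (fun _ => d) = _ := fun d => l2pair_eq_inner (hv u₀) (hd d)
  have e3b : ∀ d, l2pair g (fun _ => d) = _ := fun d => l2pair_eq_inner hg (hd d)
  have e3c : ∀ d, tensorForm A (fun y => symGrad p₂ y + iXf χ (p₁ + q₂) y) (fun _ => iX χ d) = _ :=
    fun d => tensorForm_eq_inner hA hsum (coeFn_iXL_constL χ d)
  constructor
  · rintro ⟨h0, h1, hm1, h2, hm2, h3⟩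
    simp only [e0, e1, e1', e2, e2a, e2b, e2c, e2d, e2e, e3a, e3b, e3c, hS, inner_constL_valL]
      at h0 h1 h2 h3
    exact ⟨h0, h1, hm1, h2, hm2, h3⟩
  · rintro ⟨h0, h1, hm1, h2, hm2, h3⟩
    refine ⟨fun v => ?_, fun v => ?_, hm1, fun v => ?_, hm2, fun d => ?_⟩ <;>
      simp only [e0, e1, e1', e2, e2a, e2b, e2c, e2d, e2e, e3a, e3b, e3c, hS, inner_constL_valL]
    exacts [h0 v, h1 v, h2 v, h3 d]

/-! ### Solvability and uniqueness for one cycle. -/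

lemma inner_scaledHomL (c d : Vec) :
    inner ℂ d (scaledHomL A χ c) =
      ((1 / ‖χ‖ ^ 2 : ℝ) : ℂ) * inner ℂ (iXconst χ d) (tensorL hA (correctedField A χ c)) := by
  rw [← inner_homMatrix hA, ← inner_smul_right, scaledHomL, scaledHom, map_smul]
  rfl

include hA in
lemma homDist_mul_norm_le (χ : EuclideanSpace ℝ (Fin 3)) (z : ℂ) (c : Vec) :
    homDist A χ z * ‖c‖ ≤ ‖scaledHomL A χ c - z • c‖ :=
  infDist_spectrum_mul_norm_le (isHermitian_scaledHom hA χ) z c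

lemma homDist_pos (hz : z ∈ resolventSet ℂ (scaledHom A χ)) : 0 < homDist A χ z :=
  infDist_spectrum_pos hz

include hA in
lemma scaledHomL_sub_injective (hz : z ∈ resolventSet ℂ (scaledHom A χ)) :
    Function.Injective (scaledHomL A χ - z • ContinuousLinearMap.id ℂ Vec) := by
  refine (injective_iff_map_eq_zero _).2 fun c hc => ?_
  have h : homDist A χ z * ‖c‖ ≤ ‖(scaledHomL A χ - z • ContinuousLinearMap.id ℂ Vec) c‖ :=
    homDist_mul_norm_le hA χ z c
  rw [hc, norm_zero] at h
  exact norm_eq_zero.1 (le_antisymm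
    (nonpos_of_mul_nonpos_right h (homDist_pos hz)) (norm_nonneg _))

include hA in
-- Adjoints represent the right-hand side as a vector of ℂ³; in finite dimension injectivity of
-- |χ|⁻² A_χ^hom − z yields surjectivity.
lemma exists_scaledHomL_eq (hz : z ∈ resolventSet ℂ (scaledHom A χ)) (E : L2Mat) (g : L2Vec) :
    ∃ c, ∀ d, inner ℂ d (scaledHomL A χ c) - z * inner ℂ d c =
      -(((1 / ‖χ‖ ^ 2 : ℝ) : ℂ) * inner ℂ (iXconst χ d) E) + inner ℂ (constL d) g := by
  obtain ⟨c, hc⟩ := (LinearMap.injective_iff_surjective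
    (f := (scaledHomL A χ - z • ContinuousLinearMap.id ℂ Vec).toLinearMap)).1
    (scaledHomL_sub_injective hA hz)
    (-(((1 / ‖χ‖ ^ 2 : ℝ) : ℂ) • ContinuousLinearMap.adjoint (iXconst χ) E) +
      ContinuousLinearMap.adjoint constL g)
  refine ⟨c, fun d => ?_⟩
  have h := congrArg (inner ℂ d) hc
  rw [inner_add_right, inner_neg_right, inner_smul_right,
    ContinuousLinearMap.adjoint_inner_right, ContinuousLinearMap.adjoint_inner_right] at h
  rw [← h]
  change _ = inner ℂ d (scaledHomL A χ c - z • c)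
  rw [inner_sub_right, inner_smul_right]

/-- The right-hand side of the second-order problem as an element of `H¹_#`. -/
lemma exists_load (χ : EuclideanSpace ℝ (Fin 3)) (z : ℂ) (g : L2Vec) (w s : H1per) :
    ∃ b : H1per, ∀ v, inner ℂ v b = -inner ℂ (symGradL v) (tensorL hA (iXH χ w))
        - inner ℂ (iXH χ v) (tensorL hA (symGradL w))
        - inner ℂ (iXH χ v) (tensorL hA (iXH χ s))
        + z * (‖χ‖ : ℂ) ^ 2 * inner ℂ (valL v) (valL s)
        + (‖χ‖ : ℂ) ^ 2 * inner ℂ (valL v) g := by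
  have hadj : ∀ (L : H1per →L[ℂ] L2Mat) (E : L2Mat), ∃ b, ∀ v, inner ℂ v b = inner ℂ (L v) E :=
    fun L E => ⟨_, fun v => ContinuousLinearMap.adjoint_inner_right L v E⟩
  have hadj' : ∀ E : L2Vec, ∃ b, ∀ v, inner ℂ v b = inner ℂ (valL v) E :=
    fun E => ⟨_, fun v => ContinuousLinearMap.adjoint_inner_right valL v E⟩
  obtain ⟨b₁, h₁⟩ := hadj symGradL (tensorL hA (iXH χ w))
  obtain ⟨b₂, h₂⟩ := hadj (iXH χ) (tensorL hA (symGradL w))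
  obtain ⟨b₃, h₃⟩ := hadj (iXH χ) (tensorL hA (iXH χ s))
  obtain ⟨b₄, h₄⟩ := hadj' ((z * (‖χ‖ : ℂ) ^ 2) • valL s)
  obtain ⟨b₅, h₅⟩ := hadj' ((‖χ‖ : ℂ) ^ 2 • g)
  refine ⟨-b₁ - b₂ - b₃ + b₄ + b₅, fun v => ?_⟩
  rw [inner_add_right, inner_add_right, inner_sub_right, inner_sub_right, inner_neg_right,
    h₁, h₂, h₃, h₄, h₅, inner_smul_right, inner_smul_right]

/-- The equation for the leading term is the solvability condition of the second-order problem. -/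
lemma inner_load_constH (hχ : χ ≠ 0) (hp₁ : mean p₁ = 0) (hq₂ : mean q₂ = 0) {c d : Vec}
    {b : H1per} (hu₁ : correctedField A χ c = symGradL u₁ + iXconst χ c)
    (hb : ∀ v, inner ℂ v b = -inner ℂ (symGradL v) (tensorL hA (iXH χ (u₁ + p₂)))
        - inner ℂ (iXH χ v) (tensorL hA (symGradL (u₁ + p₂)))
        - inner ℂ (iXH χ v) (tensorL hA (iXH χ (constH c + p₁ + q₂)))
        + z * (‖χ‖ : ℂ) ^ 2 * inner ℂ (valL v) (valL (constH c + p₁ + q₂))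
        + (‖χ‖ : ℂ) ^ 2 * inner ℂ (valL v) g)
    (hc : inner ℂ d (scaledHomL A χ c) - z * inner ℂ d c =
      -(((1 / ‖χ‖ ^ 2 : ℝ) : ℂ) *
        inner ℂ (iXconst χ d) (tensorL hA (symGradL p₂ + iXH χ (p₁ + q₂))))
      + inner ℂ (constL d) g) : inner ℂ (constH d) b = 0 := by
  have hn : (‖χ‖ : ℂ) ^ 2 * ((1 / ‖χ‖ ^ 2 : ℝ) : ℂ) = 1 := by
    have : (‖χ‖ : ℂ) ≠ 0 := by exact_mod_cast norm_ne_zero_iff.2 hχ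
    push_cast
    field_simp
  -- Here n = |χ|² and k = |χ|⁻². The terms a₁ + b₀ come from u₁ and c and form A_χ^hom; a₂, b₁, b₂
  -- come from p₂, p₁, q₂. The claim is the equation for c multiplied by −|χ|².
  have aux : ∀ {n k a₁ a₂ b₀ b₁ b₂ m e : ℂ}, n * k = 1 →
      k * (a₁ + b₀) - z * m = -(k * (a₂ + (b₁ + b₂))) + e →
      -0 - (a₁ + a₂) - (b₀ + b₁ + b₂) + z * n * m + n * e = 0 := by
    intro n k a₁ a₂ b₀ b₁ b₂ m e hk h
    linear_combination -n * h + (a₁ + a₂ + b₀ + b₁ + b₂) * hk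
  rw [inner_scaledHomL hA, hu₁] at hc
  simp only [map_add, inner_add_right] at hc
  rw [hb, symGradL_constH, inner_zero_left, iXH_constH, valL_constH, inner_constL_valL, mean_add,
    mean_add, mean_constH, hp₁, hq₂, add_zero, add_zero]
  simp only [map_add, inner_add_right, iXH_constH]
  exact aux hn hc

include hA in
-- The constant is found first, then its cell corrector u₁; only then does the load for u₂
-- annihilate constants. The means of p₁ and q₂ must vanish so that they drop out of the z-term
-- tested with constants.
lemma exists_cycleEqs (hχ : χ ≠ 0) (hz : z ∈ resolventSet ℂ (scaledHom A χ))
    (g : L2Vec) (hp₁ : mean p₁ = 0) (p₂ : H1per) (hq₂ : mean q₂ = 0) :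
    ∃ u₀ u₁ u₂, CycleEqs A χ z g p₁ p₂ q₂ u₀ u₁ u₂ := by
  simp only [cycleEqs_iff hA]
  obtain ⟨c, hc⟩ := exists_scaledHomL_eq hA hz
    (tensorL hA (symGradL p₂ + iXH χ (p₁ + q₂))) g
  obtain ⟨u₁, hu₁⟩ := (existsUnique_isCellCorrector hA χ c).exists
  rw [isCellCorrector_iff hA] at hu₁
  obtain ⟨b, hb⟩ := exists_load hA χ z g (u₁ + p₂) (constH c + p₁ + q₂)
  have hmb : mean b = 0 := by
    refine ext_inner_left ℂ fun d => ?_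
    rw [inner_zero_right, mean_eq_adjoint_constH, ContinuousLinearMap.adjoint_inner_right]
    exact inner_load_constH hA hχ hp₁ hq₂ (correctedField_eq hA χ hu₁.1) hb (hc d)
  obtain ⟨u₂, hu₂, hm₂⟩ := exists_solution hA hmb
  refine ⟨constH c, u₁, u₂, fun v => ?_, fun v => ?_, hu₁.2, fun v => ?_, hm₂, ?_⟩
  · rw [symGradL_constH, map_zero, inner_zero_right]
  · have h := hu₁.1 v
    rw [map_add, inner_add_right] at h
    exact eq_neg_of_add_eq_zero_left h
  · rw [hu₂, hb]
  · rw [mean_constH]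
    exact hc

include hA in
lemma CycleEqs.eq (hz : z ∈ resolventSet ℂ (scaledHom A χ)) {w₀ w₁ w₂ : H1per}
    (h : CycleEqs A χ z g p₁ p₂ q₂ u₀ u₁ u₂) (h' : CycleEqs A χ z g p₁ p₂ q₂ w₀ w₁ w₂) :
    u₀ = w₀ ∧ u₁ = w₁ ∧ u₂ = w₂ := by
  obtain ⟨h0, h1, hm1, h2, hm2, h3⟩ := (cycleEqs_iff hA).1 h
  obtain ⟨h0', h1', hm1', h2', hm2', h3'⟩ := (cycleEqs_iff hA).1 h'
  have e0 : u₀ = w₀ := by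
    refine eq_of_inner_eq hA (fun v => (h0 v).trans (h0' v).symm) ?_
    refine scaledHomL_sub_injective hA hz (ext_inner_left ℂ fun d => ?_)
    change inner ℂ d (scaledHomL A χ (mean u₀) - z • mean u₀) =
      inner ℂ d (scaledHomL A χ (mean w₀) - z • mean w₀)
    rw [inner_sub_right, inner_sub_right, inner_smul_right, inner_smul_right, h3, h3']
  subst e0
  have e1 : u₁ = w₁ :=
    eq_of_inner_eq hA (fun v => (h1 v).trans (h1' v).symm) (hm1.trans hm1'.symm)
  subst e1
  exact ⟨rfl, rfl, eq_of_inner_eq hA (fun v => (h2 v).trans (h2' v).symm) (hm2.trans hm2'.symm)⟩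

/-! ### Estimates for one cycle -/

lemma mul_norm_symGradL_le {u : H1per} {B : ℝ}
    (h : ‖(inner ℂ (symGradL u) (tensorL hA (symGradL u)) : ℂ)‖ ≤ B * ‖symGradL u‖)
    (hB : 0 ≤ B) : ν * ‖symGradL u‖ ≤ B := by
  rcases (norm_nonneg (symGradL u)).eq_or_lt with h0 | h0
  · rw [← h0, mul_zero]; exact hB
  · refine le_of_mul_le_mul_right ?_ h0
    calc ν * ‖symGradL u‖ * ‖symGradL u‖ = ν * ‖symGradL u‖ ^ 2 := by ring
      _ ≤ _ := (le_re_inner_symGradL hA u).trans ((Complex.re_le_norm _).trans h)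

lemma norm_inner_tensorL_le {E F : L2Mat} {a b : ℝ} (hE : ‖E‖ ≤ a) (hF : ‖F‖ ≤ b) :
    ‖(inner ℂ F (tensorL hA E) : ℂ)‖ ≤ b * (1 / ν * a) := by
  have hν := hA.pos
  refine (norm_inner_le_norm _ _).trans (mul_le_mul hF ((norm_tensorL_le hA E).trans ?_)
    (norm_nonneg _) ((norm_nonneg _).trans hF))
  exact mul_le_mul_of_nonneg_left hE (by positivity)

lemma norm_inner_le_of_le {E F : L2Vec} {a b : ℝ} (hE : ‖E‖ ≤ a) (hF : ‖F‖ ≤ b) :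
    ‖(inner ℂ F E : ℂ)‖ ≤ b * a :=
  (norm_inner_le_norm _ _).trans (mul_le_mul hF hE (norm_nonneg _) ((norm_nonneg _).trans hF))

include hA in
lemma CycleEqs.norm_zero_le (hχ : χ ≠ 0)
    (h : CycleEqs A χ z g p₁ p₂ q₂ u₀ u₁ u₂) :
    homDist A χ z * ‖u₀‖ ≤ 1 / ν * (‖p₂‖ / ‖χ‖ + ‖p₁ + q₂‖) + ‖g‖ := by
  obtain ⟨h0, -, -, -, -, h3⟩ := (cycleEqs_iff hA).1 h
  have hχ0 : 0 < ‖χ‖ := norm_pos_iff.2 hχ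
  have hν := hA.pos
  have hu : u₀ = constH (mean u₀) :=
    eq_constH_of_symGradL_eq_zero (symGradL_eq_zero_of_inner_eq_zero hA (h0 u₀))
  set c := mean u₀
  set r := scaledHomL A χ c - z • c with hr
  rw [hu, norm_constH]
  refine (homDist_mul_norm_le hA χ z c).trans ?_
  rw [← hr]
  set B := 1 / ν * (‖p₂‖ / ‖χ‖ + ‖p₁ + q₂‖) + ‖g‖ with hB
  have hB0 : 0 ≤ B := by positivity
  have hE : ‖symGradL p₂ + iXH χ (p₁ + q₂)‖ ≤ ‖p₂‖ + ‖χ‖ * ‖p₁ + q₂‖ :=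
    (norm_add_le _ _).trans (add_le_add (norm_symGradL_le _) (norm_iXH_le _ _))
  -- The equation for u₀ is tested with its own left-hand side r.
  have key : ‖r‖ * ‖r‖ ≤ B * ‖r‖ := by
    calc ‖r‖ * ‖r‖ = ‖(inner ℂ r r : ℂ)‖ := by
          rw [inner_self_eq_norm_sq_to_K]; simp [pow_two]
      _ = ‖-(((1 / ‖χ‖ ^ 2 : ℝ) : ℂ) *
          inner ℂ (iXconst χ r) (tensorL hA (symGradL p₂ + iXH χ (p₁ + q₂))))
          + inner ℂ (constL r) g‖ := by
          rw [← h3 r, ← inner_smul_right, ← inner_sub_right]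
      _ ≤ 1 / ‖χ‖ ^ 2 * ((‖χ‖ * ‖r‖) * (1 / ν * (‖p₂‖ + ‖χ‖ * ‖p₁ + q₂‖))) + ‖r‖ * ‖g‖ := by
          refine (norm_add_le _ _).trans (add_le_add ?_ ?_)
          · rw [norm_neg, norm_mul, Complex.norm_real, Real.norm_of_nonneg (by positivity)]
            exact mul_le_mul_of_nonneg_left (norm_inner_tensorL_le hA hE (norm_iXconst_le χ r))
              (by positivity)
          · exact (norm_inner_le_norm _ _).trans_eq (by rw [norm_constL])
      _ = B * ‖r‖ := by rw [hB]; field_simp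
  rcases (norm_nonneg r).eq_or_lt with h0' | h0'
  · rw [← h0']; exact hB0
  · exact le_of_mul_le_mul_right key h0'

include hA in
lemma CycleEqs.norm_one_le {K : ℝ} (hK : IsKornConstant K)
    (h : CycleEqs A χ z g p₁ p₂ q₂ u₀ u₁ u₂) :
    ‖u₁‖ ≤ K / ν ^ 2 * (‖χ‖ * ‖u₀‖) := by
  obtain ⟨-, h1, hm, -, -, -⟩ := (cycleEqs_iff hA).1 h
  have hν := hA.pos
  have h2 : ν * ‖symGradL u₁‖ ≤ 1 / ν * (‖χ‖ * ‖u₀‖) := by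
    refine mul_norm_symGradL_le hA ?_ (by positivity)
    rw [h1, norm_neg, mul_comm _ ‖symGradL u₁‖]
    exact norm_inner_tensorL_le hA (norm_iXH_le χ u₀) le_rfl
  have h3 := hK.2 u₁ hm
  rw [symGradNorm_eq] at h3
  have hK0 := hK.1
  calc ‖u₁‖ ≤ K * ‖symGradL u₁‖ := h3
    _ = K / ν * (ν * ‖symGradL u₁‖) := by field_simp
    _ ≤ K / ν * (1 / ν * (‖χ‖ * ‖u₀‖)) := by gcongr
    _ = _ := by field_simp

lemma norm_load_le {z a b c d e : ℂ} {r ra rb rc rd re : ℝ} (ha : ‖a‖ ≤ ra) (hb : ‖b‖ ≤ rb)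
    (hc : ‖c‖ ≤ rc) (hd : ‖d‖ ≤ rd) (he : ‖e‖ ≤ re) :
    ‖-a - b - c + z * (r : ℂ) ^ 2 * d + (r : ℂ) ^ 2 * e‖ ≤
      ra + rb + rc + ‖z‖ * r ^ 2 * rd + r ^ 2 * re := by
  have hr : ‖(r : ℂ) ^ 2‖ = r ^ 2 := by rw [norm_pow, Complex.norm_real, Real.norm_eq_abs, sq_abs]
  have h1 : ‖z * (r : ℂ) ^ 2 * d‖ ≤ ‖z‖ * r ^ 2 * rd := by
    rw [norm_mul, norm_mul, hr]; gcongr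
  have h2 : ‖(r : ℂ) ^ 2 * e‖ ≤ r ^ 2 * re := by
    rw [norm_mul, hr]; gcongr
  have h3 := norm_add_le (-a - b - c + z * (r : ℂ) ^ 2 * d) ((r : ℂ) ^ 2 * e)
  have h4 := norm_add_le (-a - b - c) (z * (r : ℂ) ^ 2 * d)
  have h5 := norm_sub_le (-a - b) c
  have h6 := norm_sub_le (-a) b
  rw [norm_neg] at h6
  linarith

include hA in
lemma CycleEqs.norm_two_le {K : ℝ} (hK : IsKornConstant K)
    (h : CycleEqs A χ z g p₁ p₂ q₂ u₀ u₁ u₂) :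
    ‖u₂‖ ≤ 2 * K ^ 2 / ν ^ 2 * (‖χ‖ * ‖u₁ + p₂‖) +
      K ^ 2 / ν * (‖χ‖ ^ 2 * ((1 / ν + ‖z‖) * ‖u₀ + p₁ + q₂‖ + ‖g‖)) := by
  obtain ⟨-, -, -, h2, hm, -⟩ := (cycleEqs_iff hA).1 h
  have hν := hA.pos
  have hK0 := hK.1
  rcases eq_or_ne u₂ 0 with rfl | hne
  · rw [norm_zero]; positivity
  have h3 := hK.2 u₂ hm
  rw [symGradNorm_eq] at h3
  -- A nonzero mean-zero function forces K ≥ 1, since ‖sym ∇u‖ ≤ ‖u‖. Hence the term tested with sym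
  -- ∇u₂ may also be given a factor K, and K² is common to all terms.
  have hK1 : 1 ≤ K := by
    have h4 : ‖u₂‖ ≤ K * ‖u₂‖ := h3.trans (by gcongr; exact norm_symGradL_le u₂)
    have : 0 < ‖u₂‖ := norm_pos_iff.2 hne
    nlinarith
  have hX2 : ‖iXH χ u₂‖ ≤ ‖χ‖ * (K * ‖symGradL u₂‖) :=
    (norm_iXH_le χ u₂).trans (mul_le_mul_of_nonneg_left h3 (norm_nonneg _))
  have hV2 : ‖valL u₂‖ ≤ K * ‖symGradL u₂‖ := (norm_valL_le u₂).trans h3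
  have hG2 : ‖symGradL u₂‖ ≤ K * ‖symGradL u₂‖ := le_mul_of_one_le_left (norm_nonneg _) hK1
  have t1 := norm_inner_tensorL_le hA (norm_iXH_le χ (u₁ + p₂)) hG2
  have t2 := norm_inner_tensorL_le hA (norm_symGradL_le (u₁ + p₂)) hX2
  have t3 := norm_inner_tensorL_le hA (norm_iXH_le χ (u₀ + p₁ + q₂)) hX2
  have t4 := norm_inner_le_of_le (norm_valL_le (u₀ + p₁ + q₂)) hV2
  have t5 := norm_inner_le_of_le (le_refl ‖g‖) hV2
  have h2' := h2 u₂
  have hB := mul_norm_symGradL_le hA (u := u₂)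
    (B := K * (2 / ν * (‖χ‖ * ‖u₁ + p₂‖) +
      ‖χ‖ ^ 2 * ((1 / ν + ‖z‖) * ‖u₀ + p₁ + q₂‖ + ‖g‖))) ?_ (by positivity)
  · generalize ‖symGradL u₂‖ = s at *
    generalize ‖u₁ + p₂‖ = W at *
    generalize ‖u₀ + p₁ + q₂‖ = S at *
    calc ‖u₂‖ ≤ K * s := h3
      _ = K / ν * (ν * s) := by field_simp
      _ ≤ K / ν * (K * (2 / ν * (‖χ‖ * W) + ‖χ‖ ^ 2 * ((1 / ν + ‖z‖) * S + ‖g‖))) :=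
          mul_le_mul_of_nonneg_left hB (by positivity)
      _ = _ := by field_simp
  · rw [h2']
    refine (norm_load_le t1 t2 t3 t4 t5).trans_eq ?_
    ring

end

/-! ### The sequence of cycles -/

section

variable {A : TensorField} {ν : ℝ} (hA : IsCoefficient A ν) {χ : EuclideanSpace ℝ (Fin 3)} {z : ℂ}

include hA in
lemma exists_isCycleTerms (hχ : χ ≠ 0) (hz : z ∈ resolventSet ℂ (scaledHom A χ)) (f : L2Vec) :
    ∃ u, IsCycleTerms A χ z f u := by
  -- The state holds u₀, u₁, u₂ of the current cycle and, in slot 3, u₂ of the preceding one, with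
  -- the zero means required for solvability.
  let S := {s : Fin 4 → H1per // mean (s 1) = 0 ∧ mean (s 2) = 0 ∧ mean (s 3) = 0}
  obtain ⟨a₀, a₁, a₂, ha⟩ := exists_cycleEqs hA hχ hz f mean_zero 0 mean_zero
  let start : S := ⟨![a₀, a₁, a₂, 0], ha.mean_one, ha.mean_two, mean_zero⟩
  have hstep : ∀ s : S, ∃ t : S,
      CycleEqs A χ z 0 (s.1 1) (s.1 2) (s.1 3) (t.1 0) (t.1 1) (t.1 2) ∧ t.1 3 = s.1 2 := by
    intro s
    obtain ⟨b₀, b₁, b₂, hb⟩ := exists_cycleEqs hA hχ hz 0 s.2.1 (s.1 2) s.2.2.2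
    exact ⟨⟨![b₀, b₁, b₂, s.1 2], hb.mean_one, hb.mean_two, s.2.2.1⟩, hb, rfl⟩
  choose next hnext hlast using hstep
  let seq : ℕ → S := fun n => Nat.rec start (fun _ s => next s) n
  refine ⟨fun n j => (seq n).1 j.castSucc, ha, hnext start, fun n => ?_⟩
  have h := hnext (seq (n + 1))
  rw [show (seq (n + 1)).1 3 = (seq n).1 2 from hlast (seq n)] at h
  exact h

include hA in
lemma IsCycleTerms.eq (hz : z ∈ resolventSet ℂ (scaledHom A χ)) {f : L2Vec}
    {u w : ℕ → Fin 3 → H1per} (hu : IsCycleTerms A χ z f u) (hw : IsCycleTerms A χ z f w) :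
    u = w := by
  have key : ∀ n, (u n 0 = w n 0 ∧ u n 1 = w n 1 ∧ u n 2 = w n 2) ∧
      (u (n + 1) 0 = w (n + 1) 0 ∧ u (n + 1) 1 = w (n + 1) 1 ∧ u (n + 1) 2 = w (n + 1) 2) := by
    intro n
    induction n with
    | zero =>
      have h0 := hu.cycle_zero.eq hA hz hw.cycle_zero
      have h1 := hu.cycle_one
      rw [h0.2.1, h0.2.2] at h1
      exact ⟨h0, h1.eq hA hz hw.cycle_one⟩
    | succ n ih =>
      have h1 := hu.cycle_succ n
      rw [ih.2.2.1, ih.2.2.2, ih.1.2.2] at h1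
      exact ⟨ih.2, h1.eq hA hz (hw.cycle_succ n)⟩
  ext1 n
  ext1 j
  fin_cases j
  exacts [(key n).1.1, (key n).1.2.1, (key n).1.2.2]

end

/-! ### Estimates -/

/-- The double geometric sum in the error bounds. -/
noncomputable def geomSum₂ (D ζ : ℝ) (a b : ℕ) : ℝ :=
  ∑ k ∈ Finset.range a, ∑ l ∈ Finset.range b, ζ ^ l / D ^ k

section GeomSum

variable {D ζ : ℝ} (hD : 0 < D) (hζ : 0 ≤ ζ)

include hD hζ in
lemma geomSum₂_nonneg (a b : ℕ) : 0 ≤ geomSum₂ D ζ a b :=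
  Finset.sum_nonneg fun _ _ => Finset.sum_nonneg fun _ _ => by positivity

include hD hζ in
lemma geomSum₂_mono {a a' b b' : ℕ} (ha : a ≤ a') (hb : b ≤ b') :
    geomSum₂ D ζ a b ≤ geomSum₂ D ζ a' b' :=
  calc geomSum₂ D ζ a b ≤ ∑ k ∈ Finset.range a, ∑ l ∈ Finset.range b', ζ ^ l / D ^ k :=
        Finset.sum_le_sum fun _ _ => Finset.sum_le_sum_of_subset_of_nonneg
          (Finset.range_mono hb) fun _ _ _ => by positivity
    _ ≤ geomSum₂ D ζ a' b' := Finset.sum_le_sum_of_subset_of_nonneg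
        (Finset.range_mono ha) fun _ _ _ => Finset.sum_nonneg fun _ _ => by positivity

include hD hζ in
-- Multiplying by D lowers the exponent of 1/D by one; the term k = 0 is surplus. So a division by D
-- is paid for by one more value of k.
lemma geomSum₂_le_mul (a b : ℕ) : geomSum₂ D ζ a b ≤ D * geomSum₂ D ζ (a + 1) b := by
  have h : D * geomSum₂ D ζ (a + 1) b =
      geomSum₂ D ζ a b + D * ∑ l ∈ Finset.range b, ζ ^ l / D ^ 0 := by
    rw [geomSum₂, Finset.sum_range_succ', mul_add, Finset.mul_sum]
    congr 1
    refine Finset.sum_congr rfl fun k _ => ?_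
    rw [Finset.mul_sum]
    refine Finset.sum_congr rfl fun l _ => ?_
    field_simp
    ring
  rw [h]
  exact le_add_of_nonneg_right (by positivity)

include hD in
-- Multiplication by ζ shifts l by one, and the new term l = 0 is nonnegative.
lemma mul_geomSum₂_le (a b : ℕ) : ζ * geomSum₂ D ζ a b ≤ geomSum₂ D ζ a (b + 1) := by
  rw [geomSum₂, Finset.mul_sum]
  refine Finset.sum_le_sum fun k _ => ?_
  rw [Finset.sum_range_succ', Finset.mul_sum]
  refine (Finset.sum_le_sum fun l _ => ?_).trans (le_add_of_nonneg_right (by positivity))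
  rw [pow_succ]
  exact le_of_eq (by ring)

lemma geomSum₂_one_one : geomSum₂ D ζ 1 1 = 1 := by simp [geomSum₂]

end GeomSum

/-! ### Propagation of the bounds from cycle to cycle. -/

lemma one_le_const0 (ν : ℝ) : 1 ≤ const0 ν := le_max_right _ _

lemma one_le_const1 (ν K : ℝ) : 1 ≤ const1 ν K := le_max_right _ _

section

variable {A : TensorField} {ν : ℝ} (hA : IsCoefficient A ν) {χ : EuclideanSpace ℝ (Fin 3)} {z : ℂ}
  {g : L2Vec} {p₁ p₂ q₂ u₀ u₁ u₂ : H1per}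

include hA in
/-- The bounds for a cycle in terms of the bounds for the two preceding cycles and for the datum;
the two alternatives are the later cycles and the initial one. -/
lemma CycleEqs.bounds {K : ℝ} (hK : IsKornConstant K) (hχ : χ ≠ 0)
    (hz : z ∈ resolventSet ℂ (scaledHom A χ))
    (h : CycleEqs A χ z g p₁ p₂ q₂ u₀ u₁ u₂) {α β R Q' P Q : ℝ}
    (hαβ : (α = 1 ∧ β = 0) ∨ (α = 0 ∧ β = 1)) (hR : 0 ≤ R) (hQ' : 0 ≤ Q')
    (hQP : Q' ≤ homDist A χ z * P) (hQ'P : Q' ≤ P) (hPQ : P ≤ Q) (hzP : ‖z‖ * P ≤ Q)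
    (hp₁ : ‖p₁‖ ≤ α * (R * Q')) (hp₂ : ‖p₂‖ ≤ α * (‖χ‖ * (R * Q'))) (hq₂ : ‖q₂‖ ≤ α * (R * Q'))
    (hg : ‖g‖ ≤ β * (R * Q')) :
    ‖u₀‖ ≤ const0 ν * (R * P) ∧ ‖u₁‖ ≤ const1 ν K * (‖χ‖ * (R * P)) ∧
      ‖u₂‖ ≤ const2 ν K * (‖χ‖ ^ 2 * (R * Q)) := by
  have hν := hA.pos
  have hν1 := hA.le_one
  have hK0 := hK.1
  have hx : 0 < ‖χ‖ := norm_pos_iff.2 hχ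
  have hD := homDist_pos hz
  have h0 := h.norm_zero_le hA hχ
  have h1 := h.norm_one_le hA hK
  have h2 := h.norm_two_le hA hK
  have hw := norm_add_le u₁ p₂
  have hs := norm_add₃_le (a := u₀) (b := p₁) (c := q₂)
  have hpq := norm_add_le p₁ q₂
  have hC0 := one_le_const0 ν
  have hC1 := one_le_const1 ν K
  have hα : 0 ≤ α := by rcases hαβ with h | h <;> simp [h.1]
  have hβ : 0 ≤ β := by rcases hαβ with h | h <;> simp [h.2]
  have hα1 : α ≤ 1 := by rcases hαβ with h | h <;> simp [h.1]
  have hP : 0 ≤ P := hQ'.trans hQ'P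
  have hQ : 0 ≤ Q := hP.trans hPQ
  generalize ‖u₀ + p₁ + q₂‖ = s at *
  generalize ‖u₁ + p₂‖ = w at *
  generalize ‖p₁ + q₂‖ = r at *
  generalize ‖u₀‖ = U₀ at *
  generalize ‖u₁‖ = U₁ at *
  generalize ‖u₂‖ = U₂ at *
  generalize ‖p₁‖ = N₁ at *
  generalize ‖p₂‖ = N₂ at *
  generalize ‖q₂‖ = N₃ at *
  have hζ : 0 ≤ ‖z‖ := norm_nonneg z
  generalize ‖g‖ = G at *
  generalize ‖z‖ = ζ at *
  generalize ‖χ‖ = x at *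
  generalize homDist A χ z = D at *
  set m := max 1 (1 / ν) with hm
  have hm1 : 1 ≤ m := le_max_left _ _
  have hmν : 1 / ν ≤ m := le_max_right _ _
  -- R Q' measures the data of the cycle, P the result of dividing by D, and Q that of a further
  -- factor |z|. Later cycles (α = 1) collect 3/ν from p₁, p₂, q₂ and the initial one (β = 1)
  -- collects 1 from the datum; C₀ is the maximum, and C₁ arises on multiplying by K/ν².
  have hb : U₀ ≤ (3 * α / ν + β) * (R * P) := by
    refine le_of_mul_le_mul_left ?_ hD
    have e1 : N₂ / x ≤ α * (R * Q') := by
      rw [div_le_iff₀ hx]; exact hp₂.trans_eq (by ring)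
    calc D * U₀ ≤ 1 / ν * (N₂ / x + r) + G := h0
      _ ≤ 1 / ν * (3 * (α * (R * Q'))) + β * (R * Q') := by
          gcongr
          linarith
      _ = (3 * α / ν + β) * (R * Q') := by ring
      _ ≤ (3 * α / ν + β) * (R * (D * P)) := by gcongr
      _ = D * ((3 * α / ν + β) * (R * P)) := by ring
  have hb0 : 3 * α / ν + β ≤ const0 ν := by
    rcases hαβ with ⟨rfl, rfl⟩ | ⟨rfl, rfl⟩
    · simp [const0]
    · simp [const0]
  have hb1 : K / ν ^ 2 * (3 * α / ν + β) ≤ const1 ν K := by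
    rcases hαβ with ⟨rfl, rfl⟩ | ⟨rfl, rfl⟩
    · refine le_trans (le_of_eq ?_) ((le_max_left _ _).trans (le_max_left _ _))
      field_simp
      ring
    · refine le_trans (le_of_eq ?_) ((le_max_right _ _).trans (le_max_left _ _))
      simp
  have c0 : U₀ ≤ const0 ν * (R * P) := hb.trans (by gcongr)
  have c1 : U₁ ≤ const1 ν K * (x * (R * P)) :=
    calc U₁ ≤ K / ν ^ 2 * (x * U₀) := h1
      _ ≤ K / ν ^ 2 * (x * ((3 * α / ν + β) * (R * P))) := by gcongr
      _ = K / ν ^ 2 * (3 * α / ν + β) * (x * (R * P)) := by ring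
      _ ≤ _ := by gcongr
  refine ⟨c0, c1, ?_⟩
  have hRQ : R * Q' ≤ R * P := by gcongr
  -- Both u₁ and p₂ are bounded with C₁; this 2 and the two mixed terms of the load give the 4 in
  -- C₂.
  have hw' : w ≤ 2 * const1 ν K * (x * (R * Q)) := by
    have e1 : N₂ ≤ const1 ν K * (x * (R * Q)) := hp₂.trans (by
      have : Q' ≤ Q := hQ'P.trans hPQ
      gcongr
      exact hα1.trans hC1)
    have e2 : U₁ ≤ const1 ν K * (x * (R * Q)) := c1.trans (by gcongr)
    linarith
  have hs' : s ≤ (1 + 2 * α) * const0 ν * (R * P) := by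
    have e1 : α * (R * Q') ≤ α * (const0 ν * (R * P)) := by
      have : R * Q' ≤ const0 ν * (R * P) :=
        hRQ.trans (le_mul_of_one_le_left (by positivity) hC0)
      gcongr
    linarith
  have hz' : (1 / ν + ζ) * P ≤ 2 * m * Q := by
    have e1 : 1 / ν * P ≤ m * Q := by gcongr
    have e2 : ζ * P ≤ m * Q := hzP.trans (le_mul_of_one_le_left hQ hm1)
    linarith
  -- The 6 is three summands in s times the two in 1/ν + ζ. In the initial cycle s has one summand
  -- and the datum adds at most one more, so 3 would do.
  have hlast : (1 / ν + ζ) * s + G ≤ 6 * m * const0 ν * (R * Q) := by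
    calc (1 / ν + ζ) * s + G
        ≤ (1 / ν + ζ) * ((1 + 2 * α) * const0 ν * (R * P)) + β * (R * Q) := by
          have : β * (R * Q') ≤ β * (R * Q) := by
            have : Q' ≤ Q := hQ'P.trans hPQ
            gcongr
          gcongr
          exact hg.trans this
      _ = (1 + 2 * α) * const0 ν * R * ((1 / ν + ζ) * P) + β * (R * Q) := by ring
      _ ≤ (1 + 2 * α) * const0 ν * R * (2 * m * Q) + β * (R * Q) := by gcongr
      _ ≤ 6 * m * const0 ν * (R * Q) := by
          have hRQ0 : 0 ≤ R * Q := by positivity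
          rcases hαβ with ⟨rfl, rfl⟩ | ⟨rfl, rfl⟩
          · exact le_of_eq (by ring)
          · have e1 : 1 * 1 * (R * Q) ≤ m * const0 ν * (R * Q) := by gcongr
            have e2 : 0 ≤ m * const0 ν * (R * Q) := by positivity
            nlinarith
  calc U₂ ≤ 2 * K ^ 2 / ν ^ 2 * (x * w) + K ^ 2 / ν * (x ^ 2 * ((1 / ν + ζ) * s + G)) := h2
    _ ≤ 2 * K ^ 2 / ν ^ 2 * (x * (2 * const1 ν K * (x * (R * Q)))) +
        K ^ 2 / ν * (x ^ 2 * (6 * m * const0 ν * (R * Q))) := by gcongr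
    _ = (4 * K ^ 2 / ν ^ 2 * const1 ν K + 6 * K ^ 2 / ν * m * const0 ν) *
        (x ^ 2 * (R * Q)) := by ring
    _ ≤ const2 ν K * (x ^ 2 * (R * Q)) := by
        have : 4 * K ^ 2 / ν ^ 2 * const1 ν K + 6 * K ^ 2 / ν * m * const0 ν ≤ const2 ν K :=
          le_max_left _ _
        gcongr

include hA in
lemma IsCycleTerms.bounds {K : ℝ} (hK : IsKornConstant K) (hχ : χ ≠ 0)
    (hz : z ∈ resolventSet ℂ (scaledHom A χ)) {f : L2Vec} {u : ℕ → Fin 3 → H1per}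
    (hu : IsCycleTerms A χ z f u) (n : ℕ) :
    ‖u n 0‖ ≤ fibreConst ν K ^ (n + 1) * geomSum₂ (homDist A χ z) ‖z‖ (n + 2) (n + 1)
        * ‖χ‖ ^ n * ‖f‖ ∧
    ‖u n 1‖ ≤ fibreConst ν K ^ (n + 1) * geomSum₂ (homDist A χ z) ‖z‖ (n + 2) (n + 1)
        * ‖χ‖ ^ (n + 1) * ‖f‖ ∧
    ‖u n 2‖ ≤ fibreConst ν K ^ (n + 1) * geomSum₂ (homDist A χ z) ‖z‖ (n + 2) (n + 2)
        * ‖χ‖ ^ (n + 2) * ‖f‖ := by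
  have hD := homDist_pos hz
  have hζ := norm_nonneg z
  have hx := norm_nonneg χ
  have hF := norm_nonneg f
  have hpos := geomSum₂_nonneg hD hζ
  have hmono := @geomSum₂_mono _ _ hD hζ
  set C := fibreConst ν K with hC
  set S := geomSum₂ (homDist A χ z) ‖z‖ with hS
  have hC0 : const0 ν ≤ C := (le_max_left _ _).trans (le_max_left _ _)
  have hC1 : const1 ν K ≤ C := (le_max_right _ _).trans (le_max_left _ _)
  have hC2 : const2 ν K ≤ C := le_max_right _ _
  have hCone : 1 ≤ C := (one_le_const0 ν).trans hC0
  -- One cycle with R = Cⁿ|χ|ⁿ‖f‖ and sums Q' = S(n+1, n+1), P = S(n+2, n+1), Q = S(n+2, n+2). For n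
  -- ≥ 1, Q' is exactly the sum bounding u₂ of cycle n − 1, so the induction closes.
  have conv : ∀ {n : ℕ} {g : L2Vec} {p₁ p₂ q₂ u₀ u₁ u₂ : H1per} {α β : ℝ},
      CycleEqs A χ z g p₁ p₂ q₂ u₀ u₁ u₂ → (α = 1 ∧ β = 0) ∨ (α = 0 ∧ β = 1) →
      ‖p₁‖ ≤ α * (C ^ n * ‖χ‖ ^ n * ‖f‖ * S (n + 1) (n + 1)) →
      ‖p₂‖ ≤ α * (‖χ‖ * (C ^ n * ‖χ‖ ^ n * ‖f‖ * S (n + 1) (n + 1))) →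
      ‖q₂‖ ≤ α * (C ^ n * ‖χ‖ ^ n * ‖f‖ * S (n + 1) (n + 1)) →
      ‖g‖ ≤ β * (C ^ n * ‖χ‖ ^ n * ‖f‖ * S (n + 1) (n + 1)) →
      ‖u₀‖ ≤ C ^ (n + 1) * S (n + 2) (n + 1) * ‖χ‖ ^ n * ‖f‖ ∧
      ‖u₁‖ ≤ C ^ (n + 1) * S (n + 2) (n + 1) * ‖χ‖ ^ (n + 1) * ‖f‖ ∧
      ‖u₂‖ ≤ C ^ (n + 1) * S (n + 2) (n + 2) * ‖χ‖ ^ (n + 2) * ‖f‖ := by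
    intro n g p₁ p₂ q₂ u₀ u₁ u₂ α β h hαβ hp₁ hp₂ hq₂ hg
    obtain ⟨b0, b1, b2⟩ := h.bounds hA hK hχ hz hαβ (R := C ^ n * ‖χ‖ ^ n * ‖f‖)
      (by positivity) (hpos (n + 1) (n + 1)) (geomSum₂_le_mul hD hζ (n + 1) (n + 1))
      (hmono (Nat.le_succ _) le_rfl) (hmono le_rfl (Nat.le_succ _))
      (mul_geomSum₂_le hD (n + 2) (n + 1)) hp₁ hp₂ hq₂ hg
    have hP := hpos (n + 2) (n + 1)
    have hQ := hpos (n + 2) (n + 2)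
    refine ⟨b0.trans ?_, b1.trans ?_, b2.trans ?_⟩
    · exact (mul_le_mul_of_nonneg_right hC0 (by positivity)).trans_eq (by ring)
    · exact (mul_le_mul_of_nonneg_right hC1 (by positivity)).trans_eq (by ring)
    · exact (mul_le_mul_of_nonneg_right hC2 (by positivity)).trans_eq (by ring)
  have h0 := conv (n := 0) hu.cycle_zero (Or.inr ⟨rfl, rfl⟩) (by simp) (by simp) (by simp)
    (by rw [hS, geomSum₂_one_one]; simp)
  have hnext₁ : ∀ {n : ℕ} {p : H1per},
      ‖p‖ ≤ C ^ (n + 1) * S (n + 2) (n + 1) * ‖χ‖ ^ (n + 1) * ‖f‖ →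
      ‖p‖ ≤ 1 * (C ^ (n + 1) * ‖χ‖ ^ (n + 1) * ‖f‖ * S (n + 1 + 1) (n + 1 + 1)) := by
    intro n p hp
    have hS1 : S (n + 2) (n + 1) ≤ S (n + 2) (n + 2) := hmono le_rfl (Nat.le_succ _)
    refine hp.trans ?_
    calc C ^ (n + 1) * S (n + 2) (n + 1) * ‖χ‖ ^ (n + 1) * ‖f‖
        ≤ C ^ (n + 1) * S (n + 2) (n + 2) * ‖χ‖ ^ (n + 1) * ‖f‖ := by gcongr
      _ = _ := by ring
  have hnext₂ : ∀ {n : ℕ} {p : H1per},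
      ‖p‖ ≤ C ^ (n + 1) * S (n + 2) (n + 2) * ‖χ‖ ^ (n + 2) * ‖f‖ →
      ‖p‖ ≤ 1 * (‖χ‖ * (C ^ (n + 1) * ‖χ‖ ^ (n + 1) * ‖f‖ * S (n + 1 + 1) (n + 1 + 1))) :=
    fun hp => hp.trans_eq (by ring)
  have h1 := conv (n := 1) hu.cycle_one (Or.inl ⟨rfl, rfl⟩) (hnext₁ h0.2.1) (hnext₂ h0.2.2)
    (by have := hpos 2 2; rw [norm_zero]; positivity) (by simp)
  have key : ∀ n,
      (‖u n 0‖ ≤ C ^ (n + 1) * S (n + 2) (n + 1) * ‖χ‖ ^ n * ‖f‖ ∧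
      ‖u n 1‖ ≤ C ^ (n + 1) * S (n + 2) (n + 1) * ‖χ‖ ^ (n + 1) * ‖f‖ ∧
      ‖u n 2‖ ≤ C ^ (n + 1) * S (n + 2) (n + 2) * ‖χ‖ ^ (n + 2) * ‖f‖) ∧
      (‖u (n + 1) 0‖ ≤ C ^ (n + 2) * S (n + 3) (n + 2) * ‖χ‖ ^ (n + 1) * ‖f‖ ∧
      ‖u (n + 1) 1‖ ≤ C ^ (n + 2) * S (n + 3) (n + 2) * ‖χ‖ ^ (n + 2) * ‖f‖ ∧
      ‖u (n + 1) 2‖ ≤ C ^ (n + 2) * S (n + 3) (n + 3) * ‖χ‖ ^ (n + 3) * ‖f‖) := by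
    intro n
    induction n with
    | zero => exact ⟨h0, h1⟩
    | succ n ih =>
      refine ⟨ih.2, conv (n := n + 2) (hu.cycle_succ n) (Or.inl ⟨rfl, rfl⟩) (hnext₁ ih.2.2.1)
        (hnext₂ ih.2.2.2) ?_ (by simp)⟩
      -- The term u₂ from two cycles back already has the required power of |χ|; it lacks only one
      -- factor C ≥ 1 and some nonnegative summands.
      have hS1 : S (n + 2) (n + 2) ≤ S (n + 3) (n + 3) := hmono (Nat.le_succ _) (Nat.le_succ _)
      have hC' : C ^ (n + 1) ≤ C ^ (n + 2) := pow_le_pow_right₀ hCone (Nat.le_succ _)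
      have hp2 := hpos (n + 2) (n + 2)
      refine ih.1.2.2.trans ?_
      calc C ^ (n + 1) * S (n + 2) (n + 2) * ‖χ‖ ^ (n + 2) * ‖f‖
          ≤ C ^ (n + 2) * S (n + 3) (n + 3) * ‖χ‖ ^ (n + 2) * ‖f‖ := by gcongr
        _ = _ := by ring
  exact (key n).1

end

end Fibre

theorem mainTheorem4 :
    (∃ K : ℝ, Fibre.IsKornConstant K) ∧
    ∀ (K : ℝ), Fibre.IsKornConstant K →
    ∀ (ν : ℝ) (A : Fibre.TensorField), Fibre.IsCoefficient A ν →
    ∀ χ : EuclideanSpace ℝ (Fin 3), χ ∈ Fibre.dualCell → χ ≠ 0 →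
      (∀ c : Fibre.Vec, ∃! w : Fibre.H1per, Fibre.IsCellCorrector A χ c w) ∧
      ∀ z : ℂ, z ∈ resolventSet ℂ (Fibre.scaledHom A χ) →
      ∀ f : Fibre.L2Vec,
        (∃! u : ℕ → Fin 3 → Fibre.H1per, Fibre.IsCycleTerms A χ z f u) ∧
        ∀ u : ℕ → Fin 3 → Fibre.H1per, Fibre.IsCycleTerms A χ z f u → ∀ n : ℕ,
          ‖u n 0‖ ≤ Fibre.fibreConst ν K ^ (n + 1) *
            (∑ k ∈ Finset.range (n + 2), ∑ l ∈ Finset.range (n + 1),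
              ‖z‖ ^ l / Fibre.homDist A χ z ^ k) * ‖χ‖ ^ n * ‖f‖ ∧
          ‖u n 1‖ ≤ Fibre.fibreConst ν K ^ (n + 1) *
            (∑ k ∈ Finset.range (n + 2), ∑ l ∈ Finset.range (n + 1),
              ‖z‖ ^ l / Fibre.homDist A χ z ^ k) * ‖χ‖ ^ (n + 1) * ‖f‖ ∧
          ‖u n 2‖ ≤ Fibre.fibreConst ν K ^ (n + 1) *
            (∑ k ∈ Finset.range (n + 2), ∑ l ∈ Finset.range (n + 2),
              ‖z‖ ^ l / Fibre.homDist A χ z ^ k) * ‖χ‖ ^ (n + 2) * ‖f‖ := by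
  refine ⟨Fibre.exists_isKornConstant, fun K hK ν A hA χ _ hχ =>
    ⟨Fibre.existsUnique_isCellCorrector hA χ, fun z hz f => ⟨?_, fun u hu n =>
      hu.bounds hA hK hχ hz n⟩⟩⟩
  obtain ⟨u, hu⟩ := Fibre.exists_isCycleTerms hA hχ hz f
  exact ⟨u, hu, fun w hw => hw.eq hA hz hu⟩
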